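/- **Definitions.** Manifolds and maps are $C^\infty$. For a 1-form $\theta$, $d\theta$ is normalised by $d\theta(X,Y)=X(\theta(Y))-Y(\theta(X))-\theta([X,Y])$. A *Pfaffian system* on $M$ is a constant rank subbundle $V\subset T^*M$; $V$ is *integrable* if $d\omega\equiv 0 \bmod V$ for its sections $\omega$, and $V^{(\infty)}$ denotes the largest integrable subbundle of $V$ (it contains every integrable subbundle of $V|_O$, for every open $O\subset M$). A pair of Pfaffian systems $\{\hat V,\check V\}$ is a *Darboux pair* if (i) $\hat V+\check V^{(\infty)}=T^*M$ and $\check V+\hat V^{(\infty)}=T^*M$; (ii) $\hat V^{(\infty)}\cap\check V^{(\infty)}=\{0\}$; (iii) $d\omega\in\Omega^2(\hat V)+\Omega^2(\check V)$ (sections of $\Lambda^2\hat V+\Lambda^2\check V$) for all $\omega\in\Omega^1(\hat V\cap\check V)$; it is always assumed that $\hat V^{(\infty)},\check V^{(\infty)}$ exist and that $\hat V^{(\infty)}\cap\check V$, $\hat V\cap\check V^{(\infty)}$ and $\hat V\cap\check V$ have constant rank. A *0-adapted coframe* on an open set $O\subset M$ consists of tuples of smooth 1-forms $(\theta,\hat\sigma,\hat\eta,\check\sigma,\check\eta)$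 with $\hat V^{(\infty)}\cap\check V=\mathrm{span}\{\hat\eta\}$, $\hat V\cap\check V^{(\infty)}=\mathrm{span}\{\check\eta\}$, $\hat V^{(\infty)}=\mathrm{span}\{\hat\sigma,\hat\eta\}$, $\check V^{(\infty)}=\mathrm{span}\{\check\sigma,\check\eta\}$, $\hat V\cap\check V=\mathrm{span}\{\theta,\hat\eta,\check\eta\}$, the last three spanning sets being pointwise linearly independent. Put $\hat\pi=(\hat\sigma,\hat\eta)$, $\check\pi=(\check\sigma,\check\eta)$. Below, capital letters other than $C,X,Y$ denote arbitrary coefficient functions. The coframe is *1-adapted* if $d\hat\sigma=0$, $d\hat\eta=\hat E\,\hat\eta\wedge\hat\sigma+\hat F\,\hat\sigma\wedge\hat\sigma$, $d\check\sigma=0$, $d\check\eta=\check E\,\check\eta\wedge\check\sigma+\check F\,\check\sigma\wedge\check\sigma$ and $d\theta\equiv A\,\hat\sigma\wedge\hat\sigma+B\,\check\sigma\wedge\check\sigma \bmod\{\theta,\hat\eta,\check\eta\}$, and *2-adapted* if moreover $d\theta\equiv A\,\hat\pi\wedge\hat\pi+B\,\check\pi\wedge\check\pi \bmod\{\theta\}$.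 A *4-adapted coframe* on $O$ is a pair of 2-adapted coframes $\{\theta_X^i,\hat\pi^a,\check\pi^\alpha\}$, $\{\theta_Y^i,\hat\pi^a,\check\pi^\alpha\}$ on $O$, with the same $\hat\sigma,\hat\eta,\check\sigma,\check\eta$ and with $\mathrm{span}\{\theta_X\}=\mathrm{span}\{\theta_Y\}$, such that the vector fields $X_i$ and $Y_j$ dual to $\theta_X^i$ and $\theta_Y^j$ in the respective dual frames satisfy $[X_i,Y_j]=0$, and $$d\theta_X^i=\tfrac12A^i_{ab}\hat\pi^a\wedge\hat\pi^b+\tfrac12B^i_{\alpha\beta}\check\pi^\alpha\wedge\check\pi^\beta+\tfrac12C^i_{jk}\theta_X^j\wedge\theta_X^k+M^i_{aj}\hat\pi^a\wedge\theta_X^j,$$ $$d\theta_Y^i=\tfrac12E^i_{ab}\hat\pi^a\wedge\hat\pi^b+\tfrac12F^i_{\alpha\beta}\check\pi^\alpha\wedge\check\pi^\beta-\tfrac12C^i_{jk}\theta_Y^j\wedge\theta_Y^k+N^i_{\alpha j}\check\pi^\alpha\wedge\theta_Y^j,$$ where the $C^i_{jk}=-C^i_{kj}$ are constants and are the structure constants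 of a real Lie algebra. The *Vessiot algebra* $\mathfrak{vess}(\hat V,\check V)$, computed from this coframe, is the Lie algebra with basis $e_i$ and brackets $[e_j,e_k]=C^i_{jk}e_i$; it is realized at $x\in O$ by the tangent vectors $e_i\mapsto X_i(x)$. **Corollary 4.7.** Let $\{\hat V,\check V\}$ and $\{\hat W,\check W\}$ be Darboux pairs on finite-dimensional manifolds $M$ and $N$, and let $\phi:M\to N$ be a smooth map such that $\phi^*(\hat W)\subset\hat V$ and $\phi^*(\check W)\subset\check V$. Then $\phi$ induces a Lie algebra homomorphism $\tilde\phi:\mathfrak{vess}(\hat V,\check V)\to\mathfrak{vess}(\hat W,\check W)$. Precisely: let $\{\theta_X,\theta_Y,\hat\pi,\check\pi\}$ be any 4-adapted coframe for $\{\hat V,\check V\}$ on an open set $O\subset M$, and $\{\theta'_X,\theta'_Y,\hat\pi',\check\pi'\}$ any 4-adapted coframe for $\{\hat W,\check W\}$ on an open set $O'\subset N$, with dual vector fields $X_i$ and $X'_s$ and Vessiot algebras with bases $e_i$ and $e'_s$. Then for every $x\in O$ with $\phi(x)\in O'$ there is a unique Lie algebra homomorphism $\tilde\phi:\mathfrak{vess}(\hat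 V,\check V)\to\mathfrak{vess}(\hat W,\check W)$, $\tilde\phi(e_i)=\sum_sR_i^s e'_s$, realized by the Jacobian of $\phi$, that is, $\phi_{*,x}(X_i(x))=\sum_sR_i^s X'_s(\phi(x))$ for all $i$. -/

import Mathlib

open scoped Manifold ContDiff Topology

noncomputable section

namespace Vessiot

section Forms

variable (E : Type*) [NormedAddCommGroup E] [NormedSpace ℝ E]
  (M : Type*) [TopologicalSpace M] [ChartedSpace E M]

/-- A (not necessarily smooth) differential 1-form on `M`. -/
abbrev OneForm : Type _ := (x : M) → (TangentSpace 𝓘(ℝ, E) x →L[ℝ] ℝ)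

/-- A (not necessarily smooth) vector field on `M`. -/
abbrev VField : Type _ := (x : M) → TangentSpace 𝓘(ℝ, E) x

/-- A field of linear subspaces of the fibres of the cotangent bundle `T^*M`. -/
abbrev CoDistribution : Type _ := (x : M) → Submodule ℝ (TangentSpace 𝓘(ℝ, E) x →L[ℝ] ℝ)

variable {E M}

/-- `τ` is a `C^∞` 1-form on `O`: a smooth section of the cotangent bundle over `O`. -/
def SmoothFormOn [IsManifold 𝓘(ℝ, E) ∞ M] (τ : OneForm E M) (O : Set M) : Prop :=
  ContMDiffOn 𝓘(ℝ, E) (𝓘(ℝ, E).prod 𝓘(ℝ, E →L[ℝ] ℝ)) ∞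
    (fun x : M => Bundle.TotalSpace.mk' (E →L[ℝ] ℝ)
      (E := fun y : M => (TangentSpace 𝓘(ℝ, E) y →L[ℝ] ℝ)) x (τ x)) O

/-- The pull-back of the 1-form `τ` to the model space by the inverse of the chart at `x`,
written as a field of alternating 1-linear forms. -/
def localForm (τ : OneForm E M) (x : M) : E → E [⋀^Fin 1]→L[ℝ] ℝ := fun y =>
  ContinuousAlternatingMap.ofSubsingleton ℝ E ℝ (0 : Fin 1)
    ((τ ((extChartAt 𝓘(ℝ, E) x).symm y)).comp
      (mfderiv 𝓘(ℝ, E) 𝓘(ℝ, E) (extChartAt 𝓘(ℝ, E) x).symm y))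

/-- The value at `x` of the exterior derivative `dτ` of a 1-form `τ`, as a function of two tangent
vectors: the exterior derivative is taken in the chart at `x` and pulled back to `M`. It is
normalised so that `dτ(X, Y) = X(τ(Y)) - Y(τ(X)) - τ([X, Y])`. -/
def extD (τ : OneForm E M) (x : M) : TangentSpace 𝓘(ℝ, E) x → TangentSpace 𝓘(ℝ, E) x → ℝ :=
  fun u v =>
    extDeriv (localForm τ x) (extChartAt 𝓘(ℝ, E) x x)
      ![mfderiv 𝓘(ℝ, E) 𝓘(ℝ, E) (extChartAt 𝓘(ℝ, E) x) x u,
        mfderiv 𝓘(ℝ, E) 𝓘(ℝ, E) (extChartAt 𝓘(ℝ, E) x) x v]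

end Forms

section Pointwise

variable {T : Type*} [AddCommGroup T] [Module ℝ T] [TopologicalSpace T]

/-- The wedge product of two covectors, `(α ∧ β)(u, v) = α(u) β(v) - α(v) β(u)`. -/
def wedge (α β : T →L[ℝ] ℝ) : T → T → ℝ := fun u v => α u * β v - α v * β u

variable [IsTopologicalAddGroup T] [ContinuousSMul ℝ T]

/-- The space of 2-covectors `A ∧ B` spanned by the products `α ∧ β` with `α ∈ A`, `β ∈ B`.
In particular `wedgeSpan A A` is `Λ²A`, and `wedgeSpan A ⊤` is the degree two part of the algebraic
ideal generated by `A`. -/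
def wedgeSpan (A B : Submodule ℝ (T →L[ℝ] ℝ)) : Submodule ℝ (T → T → ℝ) :=
  Submodule.span ℝ {b | ∃ α ∈ A, ∃ β ∈ B, b = wedge α β}

end Pointwise

section Pfaffian

variable {E : Type*} [NormedAddCommGroup E] [NormedSpace ℝ E]
  {M : Type*} [TopologicalSpace M] [ChartedSpace E M] [IsManifold 𝓘(ℝ, E) ∞ M]

/-- The pointwise span of a tuple of 1-forms. -/
def sp {n : ℕ} (τ : Fin n → OneForm E M) : CoDistribution E M :=
  fun x => Submodule.span ℝ (Set.range fun i => τ i x)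

/-- `τ¹, …, τⁿ` are smooth 1-forms on the open set `O`, independent and spanning `V` at each of its
points. -/
structure IsFrameOn {n : ℕ} (V : CoDistribution E M) (O : Set M) (τ : Fin n → OneForm E M) :
    Prop where
  isOpen : IsOpen O
  smooth : ∀ i, SmoothFormOn (τ i) O
  independent : ∀ x ∈ O, LinearIndependent ℝ fun i => τ i x
  span_eq : ∀ x ∈ O, sp τ x = V x

/-- Over `O`, `V` is a constant rank (smooth) subbundle of the cotangent bundle. -/
def IsSubbundleOn (V : CoDistribution E M) (O : Set M) : Prop :=
  ∃ n : ℕ, ∀ x ∈ O, ∃ (U : Set M) (τ : Fin n → OneForm E M), x ∈ U ∧ U ⊆ O ∧ IsFrameOn V U τ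

/-- Over `O`, `V` is an integrable (constant rank, smooth) subbundle of the cotangent bundle: about
each point it has a local frame `τ¹, …, τⁿ` with `dτⁱ ≡ 0 mod V`, that is, `dτⁱ` vanishes on pairs
of tangent vectors annihilated by `V`. -/
def IsIntegrableSubbundleOn (V : CoDistribution E M) (O : Set M) : Prop :=
  ∃ n : ℕ, ∀ x ∈ O, ∃ (U : Set M) (τ : Fin n → OneForm E M), x ∈ U ∧ U ⊆ O ∧ IsFrameOn V U τ ∧
    ∀ y ∈ U, ∀ i, ∀ u v : TangentSpace 𝓘(ℝ, E) y,
      (∀ α ∈ V y, α u = 0) → (∀ α ∈ V y, α v = 0) → extD (τ i) y u v = 0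

/-- `V^(∞)`: its fibre at `x` is the sum of the fibres at `x` of all the integrable subbundles of
`V` that are defined in a neighbourhood of `x`. Whenever this is itself an integrable subbundle, it
is the largest integrable subbundle of `V`. -/
def derivedInf (V : CoDistribution E M) : CoDistribution E M := fun x =>
  sSup {S | ∃ (O : Set M) (U : CoDistribution E M), IsOpen O ∧ x ∈ O ∧
    IsIntegrableSubbundleOn U O ∧ (∀ y ∈ O, U y ≤ V y) ∧ S = U x}

/-- The pair of Pfaffian systems `Vh` (hat) and `Vc` (check) is a Darboux pair on `M`, together with
the standing regularity assumptions: `Vh`, `Vc` are constant rank subbundles of the cotangent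
bundle, they have largest integrable subbundles, and the intersections below have constant rank. -/
structure IsDarbouxPair (Vh Vc : CoDistribution E M) : Prop where
  subbundle_h : IsSubbundleOn Vh Set.univ
  subbundle_c : IsSubbundleOn Vc Set.univ
  integrable_h : IsIntegrableSubbundleOn (derivedInf Vh) Set.univ
  integrable_c : IsIntegrableSubbundleOn (derivedInf Vc) Set.univ
  inter_h : IsSubbundleOn (fun x => derivedInf Vh x ⊓ Vc x) Set.univ
  inter_c : IsSubbundleOn (fun x => Vh x ⊓ derivedInf Vc x) Set.univ
  inter_hc : IsSubbundleOn (fun x => Vh x ⊓ Vc x) Set.univ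
  sum_h : ∀ x, Vh x ⊔ derivedInf Vc x = ⊤
  sum_c : ∀ x, Vc x ⊔ derivedInf Vh x = ⊤
  inter_inf : ∀ x, derivedInf Vh x ⊓ derivedInf Vc x = ⊥
  decomposable : ∀ (O : Set M) (τ : OneForm E M), IsOpen O → SmoothFormOn τ O →
    (∀ x ∈ O, τ x ∈ Vh x ⊓ Vc x) →
    ∀ x ∈ O, extD τ x ∈ wedgeSpan (Vh x) (Vh x) ⊔ wedgeSpan (Vc x) (Vc x)

/-- `(θ, σh, ηh, σc, ηc)` is a 0-adapted coframe on `O`. -/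
structure IsZeroAdapted {r ph qh pc qc : ℕ} (Vh Vc : CoDistribution E M) (O : Set M)
    (θ : Fin r → OneForm E M) (σh : Fin ph → OneForm E M) (ηh : Fin qh → OneForm E M)
    (σc : Fin pc → OneForm E M) (ηc : Fin qc → OneForm E M) : Prop where
  isOpen : IsOpen O
  smooth_θ : ∀ i, SmoothFormOn (θ i) O
  smooth_σh : ∀ i, SmoothFormOn (σh i) O
  smooth_ηh : ∀ i, SmoothFormOn (ηh i) O
  smooth_σc : ∀ i, SmoothFormOn (σc i) O
  smooth_ηc : ∀ i, SmoothFormOn (ηc i) O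
  span_ηh : ∀ x ∈ O, derivedInf Vh x ⊓ Vc x = sp ηh x
  span_ηc : ∀ x ∈ O, Vh x ⊓ derivedInf Vc x = sp ηc x
  span_h : ∀ x ∈ O, derivedInf Vh x = sp σh x ⊔ sp ηh x
  span_c : ∀ x ∈ O, derivedInf Vc x = sp σc x ⊔ sp ηc x
  span_hc : ∀ x ∈ O, Vh x ⊓ Vc x = sp θ x ⊔ sp ηh x ⊔ sp ηc x
  indep_h : ∀ x ∈ O, LinearIndependent ℝ
    (Sum.elim (fun i => σh i x) (fun i => ηh i x) : Fin ph ⊕ Fin qh → _)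
  indep_c : ∀ x ∈ O, LinearIndependent ℝ
    (Sum.elim (fun i => σc i x) (fun i => ηc i x) : Fin pc ⊕ Fin qc → _)
  indep_hc : ∀ x ∈ O, LinearIndependent ℝ
    (Sum.elim (fun i => θ i x) (Sum.elim (fun i => ηh i x) (fun i => ηc i x)) :
      Fin r ⊕ (Fin qh ⊕ Fin qc) → _)

/-- 1-adapted coframes: `dσh = 0`, `dηh ∈ ηh ∧ σh + σh ∧ σh`, the same for `σc`, `ηc`, and
`dθ ≡ A σh ∧ σh + B σc ∧ σc mod {θ, ηh, ηc}`. -/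
structure IsOneAdapted {r ph qh pc qc : ℕ} (Vh Vc : CoDistribution E M) (O : Set M)
    (θ : Fin r → OneForm E M) (σh : Fin ph → OneForm E M) (ηh : Fin qh → OneForm E M)
    (σc : Fin pc → OneForm E M) (ηc : Fin qc → OneForm E M) : Prop
    extends IsZeroAdapted Vh Vc O θ σh ηh σc ηc where
  d_σh : ∀ x ∈ O, ∀ i, extD (σh i) x = 0
  d_σc : ∀ x ∈ O, ∀ i, extD (σc i) x = 0
  d_ηh : ∀ x ∈ O, ∀ i, extD (ηh i) x ∈
    wedgeSpan (sp ηh x) (sp σh x) ⊔ wedgeSpan (sp σh x) (sp σh x)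
  d_ηc : ∀ x ∈ O, ∀ i, extD (ηc i) x ∈
    wedgeSpan (sp ηc x) (sp σc x) ⊔ wedgeSpan (sp σc x) (sp σc x)
  d_θ_mod : ∀ x ∈ O, ∀ i, extD (θ i) x ∈
    wedgeSpan (sp σh x) (sp σh x) ⊔ wedgeSpan (sp σc x) (sp σc x) ⊔
      wedgeSpan (sp θ x ⊔ sp ηh x ⊔ sp ηc x) ⊤

/-- 2-adapted coframes: with `πh = (σh, ηh)` and `πc = (σc, ηc)`, the coframe is 1-adapted and
`dθ ≡ A πh ∧ πh + B πc ∧ πc mod {θ}`. -/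
structure IsTwoAdapted {r ph qh pc qc : ℕ} (Vh Vc : CoDistribution E M) (O : Set M)
    (θ : Fin r → OneForm E M) (σh : Fin ph → OneForm E M) (ηh : Fin qh → OneForm E M)
    (σc : Fin pc → OneForm E M) (ηc : Fin qc → OneForm E M) : Prop
    extends IsOneAdapted Vh Vc O θ σh ηh σc ηc where
  d_θ_mod_θ : ∀ x ∈ O, ∀ i, extD (θ i) x ∈
    wedgeSpan (sp σh x ⊔ sp ηh x) (sp σh x ⊔ sp ηh x) ⊔
      wedgeSpan (sp σc x ⊔ sp ηc x) (sp σc x ⊔ sp ηc x) ⊔ wedgeSpan (sp θ x) ⊤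

/-- `X` is the part dual to `θ` of the frame dual to the coframe `(θ, σh, ηh, σc, ηc)` on `O`. -/
structure IsDualTo {r ph qh pc qc : ℕ} (O : Set M) (X : Fin r → VField E M)
    (θ : Fin r → OneForm E M) (σh : Fin ph → OneForm E M) (ηh : Fin qh → OneForm E M)
    (σc : Fin pc → OneForm E M) (ηc : Fin qc → OneForm E M) : Prop where
  pair_θ : ∀ x ∈ O, ∀ i j, θ i x (X j x) = if i = j then 1 else 0
  pair_σh : ∀ x ∈ O, ∀ a j, σh a x (X j x) = 0
  pair_ηh : ∀ x ∈ O, ∀ a j, ηh a x (X j x) = 0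
  pair_σc : ∀ x ∈ O, ∀ a j, σc a x (X j x) = 0
  pair_ηc : ∀ x ∈ O, ∀ a j, ηc a x (X j x) = 0

/-- The coframes `(θX, σh, ηh, σc, ηc)` and `(θY, σh, ηh, σc, ηc)`, the vector fields `X`, `Y` of
whose dual frames are dual to `θX`, `θY`, are 3-adapted:
`dθX = A πh ∧ πh + B πc ∧ πc + C θX ∧ θX + M πh ∧ θX`,
`dθY = E πh ∧ πh + F πc ∧ πc + K θY ∧ θY + N πc ∧ θY`,
`span θX = span θY` and `[X, Y] = 0`. -/
structure IsThreeAdapted {r ph qh pc qc : ℕ} (Vh Vc : CoDistribution E M) (O : Set M)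
    (θX θY : Fin r → OneForm E M) (X Y : Fin r → VField E M)
    (σh : Fin ph → OneForm E M) (ηh : Fin qh → OneForm E M)
    (σc : Fin pc → OneForm E M) (ηc : Fin qc → OneForm E M) : Prop where
  twoAdapted_X : IsTwoAdapted Vh Vc O θX σh ηh σc ηc
  twoAdapted_Y : IsTwoAdapted Vh Vc O θY σh ηh σc ηc
  dual_X : IsDualTo O X θX σh ηh σc ηc
  dual_Y : IsDualTo O Y θY σh ηh σc ηc
  d_θX : ∀ x ∈ O, ∀ i, extD (θX i) x ∈
    wedgeSpan (sp σh x ⊔ sp ηh x) (sp σh x ⊔ sp ηh x) ⊔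
      wedgeSpan (sp σc x ⊔ sp ηc x) (sp σc x ⊔ sp ηc x) ⊔
      wedgeSpan (sp θX x) (sp θX x) ⊔ wedgeSpan (sp σh x ⊔ sp ηh x) (sp θX x)
  d_θY : ∀ x ∈ O, ∀ i, extD (θY i) x ∈
    wedgeSpan (sp σh x ⊔ sp ηh x) (sp σh x ⊔ sp ηh x) ⊔
      wedgeSpan (sp σc x ⊔ sp ηc x) (sp σc x ⊔ sp ηc x) ⊔
      wedgeSpan (sp θY x) (sp θY x) ⊔ wedgeSpan (sp σc x ⊔ sp ηc x) (sp θY x)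
  span_eq : ∀ x ∈ O, sp θX x = sp θY x
  commute : ∀ x ∈ O, ∀ i j, VectorField.mlieBracket 𝓘(ℝ, E) (X i) (Y j) x = 0

/-- A 4-adapted coframe on an open set `O`: a pair of 3-adapted coframes for which the structure
functions are constants `C i j k = Cⁱ_{jk}`, the structure constants of a real Lie algebra, with
`dθXⁱ = ½ A πh ∧ πh + ½ B πc ∧ πc + ½ Cⁱ_{jk} θXʲ ∧ θXᵏ + M πh ∧ θX` and
`dθYⁱ = ½ E πh ∧ πh + ½ F πc ∧ πc - ½ Cⁱ_{jk} θYʲ ∧ θYᵏ + N πc ∧ θY`. -/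
structure FourAdaptedCoframe (Vh Vc : CoDistribution E M) where
  O : Set M
  {r : ℕ}
  {ph : ℕ}
  {qh : ℕ}
  {pc : ℕ}
  {qc : ℕ}
  θX : Fin r → OneForm E M
  θY : Fin r → OneForm E M
  X : Fin r → VField E M
  Y : Fin r → VField E M
  σh : Fin ph → OneForm E M
  ηh : Fin qh → OneForm E M
  σc : Fin pc → OneForm E M
  ηc : Fin qc → OneForm E M
  C : Fin r → Fin r → Fin r → ℝ
  threeAdapted : IsThreeAdapted Vh Vc O θX θY X Y σh ηh σc ηc
  structure_X : ∀ x ∈ O, ∀ i,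
    extD (θX i) x - (1 / 2 : ℝ) • ∑ j, ∑ k, C i j k • wedge (θX j x) (θX k x) ∈
      wedgeSpan (sp σh x ⊔ sp ηh x) (sp σh x ⊔ sp ηh x) ⊔
        wedgeSpan (sp σc x ⊔ sp ηc x) (sp σc x ⊔ sp ηc x) ⊔
        wedgeSpan (sp σh x ⊔ sp ηh x) (sp θX x)
  structure_Y : ∀ x ∈ O, ∀ i,
    extD (θY i) x + (1 / 2 : ℝ) • ∑ j, ∑ k, C i j k • wedge (θY j x) (θY k x) ∈
      wedgeSpan (sp σh x ⊔ sp ηh x) (sp σh x ⊔ sp ηh x) ⊔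
        wedgeSpan (sp σc x ⊔ sp ηc x) (sp σc x ⊔ sp ηc x) ⊔
        wedgeSpan (sp σc x ⊔ sp ηc x) (sp θY x)
  antisymm : ∀ i j k, C i j k = -C i k j
  jacobi : ∀ i j k l,
    ∑ m, (C i j m * C m k l + C i k m * C m l j + C i l m * C m j k) = 0

namespace FourAdaptedCoframe

variable {Vh Vc : CoDistribution E M}

/-- The Vessiot algebra `vess(Vh, Vc)` computed from the 4-adapted coframe `F`: the Lie algebra
with basis `e_1, …, e_r` and bracket `[e_j, e_k] = ∑ i, Cⁱ_{jk} e_i`. -/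
def Vess (F : FourAdaptedCoframe Vh Vc) : Type := Fin F.r → ℝ

instance (F : FourAdaptedCoframe Vh Vc) : AddCommGroup F.Vess :=
  inferInstanceAs (AddCommGroup (Fin F.r → ℝ))

instance (F : FourAdaptedCoframe Vh Vc) : Module ℝ F.Vess :=
  inferInstanceAs (Module ℝ (Fin F.r → ℝ))

instance (F : FourAdaptedCoframe Vh Vc) : Bracket F.Vess F.Vess :=
  ⟨fun u v => (fun i => ∑ j, ∑ k, F.C i j k * u j * v k : Fin F.r → ℝ)⟩

theorem lie_apply (F : FourAdaptedCoframe Vh Vc) (u v : F.Vess) (i : Fin F.r) :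
    ⁅u, v⁆ i = ∑ j, ∑ k, F.C i j k * u j * v k := rfl

theorem Vess.add_apply (F : FourAdaptedCoframe Vh Vc) (u v : F.Vess) (i : Fin F.r) :
    (u + v) i = u i + v i := rfl

theorem Vess.smul_apply (F : FourAdaptedCoframe Vh Vc) (c : ℝ) (v : F.Vess) (i : Fin F.r) :
    (c • v) i = c * v i := rfl

theorem lie_lie_apply (F : FourAdaptedCoframe Vh Vc) (u v w : F.Vess) (i : Fin F.r) :
    ⁅u, ⁅v, w⁆⁆ i = ∑ j, ∑ k, ∑ l, (∑ m, F.C i j m * F.C m k l) * (u j * v k * w l) := by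
  simp only [lie_apply, Finset.mul_sum, Finset.sum_mul]
  refine Finset.sum_congr rfl fun j _ => ?_
  rw [Finset.sum_comm]
  refine Finset.sum_congr rfl fun k _ => ?_
  rw [Finset.sum_comm]
  exact Finset.sum_congr rfl fun l _ => Finset.sum_congr rfl fun m _ => by ring

theorem lie_skew_apply (F : FourAdaptedCoframe Vh Vc) (u v : F.Vess) (i : Fin F.r) :
    ⁅u, v⁆ i = -⁅v, u⁆ i := by
  simp only [lie_apply]
  rw [Finset.sum_comm, ← Finset.sum_neg_distrib]
  refine Finset.sum_congr rfl fun j _ => ?_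
  rw [← Finset.sum_neg_distrib]
  refine Finset.sum_congr rfl fun k _ => ?_
  rw [F.antisymm i k j]
  ring

theorem jacobi_apply (F : FourAdaptedCoframe Vh Vc) (u v w : F.Vess) (i : Fin F.r) :
    ⁅u, ⁅v, w⁆⁆ i + ⁅v, ⁅w, u⁆⁆ i + ⁅w, ⁅u, v⁆⁆ i = 0 := by
  have h2 : ⁅v, ⁅w, u⁆⁆ i =
      ∑ j, ∑ k, ∑ l, (∑ m, F.C i k m * F.C m l j) * (u j * v k * w l) := by
    rw [lie_lie_apply, Finset.sum_congr rfl fun k _ => Finset.sum_comm, Finset.sum_comm]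
    exact Finset.sum_congr rfl fun j _ => Finset.sum_congr rfl fun k _ =>
      Finset.sum_congr rfl fun l _ => by ring
  have h3 : ⁅w, ⁅u, v⁆⁆ i =
      ∑ j, ∑ k, ∑ l, (∑ m, F.C i l m * F.C m j k) * (u j * v k * w l) := by
    rw [lie_lie_apply, Finset.sum_comm]
    refine Finset.sum_congr rfl fun j _ => ?_
    rw [Finset.sum_comm]
    exact Finset.sum_congr rfl fun k _ => Finset.sum_congr rfl fun l _ => by ring
  rw [h2, h3, lie_lie_apply]
  simp only [← Finset.sum_add_distrib, ← add_mul, F.jacobi, zero_mul, Finset.sum_const_zero]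

instance (F : FourAdaptedCoframe Vh Vc) : LieRing F.Vess where
  add_lie u v w := by
    funext i
    simp only [lie_apply, Vess.add_apply, ← Finset.sum_add_distrib]
    exact Finset.sum_congr rfl fun j _ => Finset.sum_congr rfl fun k _ => by ring
  lie_add u v w := by
    funext i
    simp only [lie_apply, Vess.add_apply, ← Finset.sum_add_distrib]
    exact Finset.sum_congr rfl fun j _ => Finset.sum_congr rfl fun k _ => by ring
  lie_self u := by
    funext i
    change ⁅u, u⁆ i = 0
    linarith [lie_skew_apply F u u i]
  leibniz_lie u v w := by
    funext i
    rw [Vess.add_apply, lie_skew_apply F ⁅u, v⁆ w]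
    have h : ⁅v, ⁅u, w⁆⁆ i = -⁅v, ⁅w, u⁆⁆ i := by
      have h1 : ∀ k, ⁅u, w⁆ k = -⁅w, u⁆ k := lie_skew_apply F u w
      rw [lie_apply, lie_apply]
      simp only [h1, mul_neg, Finset.sum_neg_distrib]
    linarith [jacobi_apply F u v w i]

instance (F : FourAdaptedCoframe Vh Vc) : LieAlgebra ℝ F.Vess where
  lie_smul c u v := by
    funext i
    simp only [lie_apply, Vess.smul_apply, Finset.mul_sum]
    exact Finset.sum_congr rfl fun j _ => Finset.sum_congr rfl fun k _ => by ring

/-- The realization of the Vessiot algebra by tangent vectors at `x`: `e_i ↦ X_i(x)`. -/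
def realize (F : FourAdaptedCoframe Vh Vc) (x : M) (v : F.Vess) : TangentSpace 𝓘(ℝ, E) x :=
  ∑ i, v i • F.X i x

end FourAdaptedCoframe

end Pfaffian

end Vessiot

end

/-! Call a tangent vector vertical when it is killed by both maximal integrable subsystems; the `X
i` span the vertical vectors. An integrable subsystem of the hat (or check) system on `N` pulls back
to a differentially closed family inside the corresponding system on `M`, so `φ^*` respects the
maximal integrable subsystems and `φ_*` keeps vertical vectors vertical. Hence `φ_*` sends each `X
i` to a combination of the fields `X'` of the target. The matrix `R` of this map also gives the `θX`
coefficients of the pulled-back forms `φ^*θ'`, which lie in `Vh ∩ Vc` and so are combinations of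
`θX`, `ηh`, `ηc`.

On vertical pairs `dθX` is given by the structure constants alone. So `R` respects brackets once
`d(φ^*θ') = ∑ R dθX` on such pairs, that is, once the terms `dR ∧ θX` drop out. They do because
`dθX` has no term in `πc ∧ θX`: it vanishes on `(u, v)` when `Vh` kills `u` and `v` is vertical, and
the same holds on `N`. Evaluating `d(φ^*θ')` on `(u, X k)` therefore leaves `dR_k(u) = 0`, whence
`dR_k` lies in `Vh`. Being exact, it lies in the maximal integrable subsystem of `Vh`, so it kills
vertical vectors.

The weight is carried by `mem_derivedInf_of_closed`, `pullback_mem_derivedInf`,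
`FourAdaptedCoframe.realize_θX` and `exists_structure_pullback_θX`. -/

noncomputable section

namespace Vessiot

/-! ### 1-forms and their exterior derivatives in charts. -/

section ChartForms

variable {E : Type*} [NormedAddCommGroup E] [NormedSpace ℝ E]
  {M : Type*} [TopologicalSpace M] [ChartedSpace E M]

/-- The pull-back of the 1-form `τ` to the model space by the inverse of the chart at `x`. -/
def chartForm (τ : OneForm E M) (x : M) : E → E →L[ℝ] ℝ := fun z =>
  (τ ((extChartAt 𝓘(ℝ, E) x).symm z)).comp
    (mfderiv 𝓘(ℝ, E) 𝓘(ℝ, E) (extChartAt 𝓘(ℝ, E) x).symm z)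

/-- `τ` is smooth at `x`, in terms of the chart at `x`. -/
def SmoothFormAt (τ : OneForm E M) (x : M) : Prop :=
  ContDiffAt ℝ ∞ (chartForm τ x) (extChartAt 𝓘(ℝ, E) x x)

theorem localForm_eq (τ : OneForm E M) (x : M) :
    localForm τ x = fun z => ContinuousAlternatingMap.ofSubsingletonLIE (ι := Fin 1) (𝕜 := ℝ) (E := E) (F := ℝ) 0
      (chartForm τ x z) := rfl

theorem extDeriv_ofSubsingleton {α : E → E →L[ℝ] ℝ} {z : E}
    (hα : DifferentiableAt ℝ α z) (u v : E) :
    extDeriv (fun z => ContinuousAlternatingMap.ofSubsingletonLIE (ι := Fin 1) (𝕜 := ℝ) (E := E) (F := ℝ) 0 (α z)) z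
      ![u, v] = fderiv ℝ α z u v - fderiv ℝ α z v u := by
  have h : HasFDerivAt
      (fun z => ContinuousAlternatingMap.ofSubsingletonLIE (ι := Fin 1) (𝕜 := ℝ) (E := E) (F := ℝ) 0 (α z))
      (((ContinuousAlternatingMap.ofSubsingletonLIE (ι := Fin 1) (𝕜 := ℝ) (E := E) (F := ℝ) 0).toContinuousLinearEquiv :
        (E →L[ℝ] ℝ) →L[ℝ] E [⋀^Fin 1]→L[ℝ] ℝ).comp (fderiv ℝ α z)) z :=
    (ContinuousAlternatingMap.ofSubsingletonLIE (ι := Fin 1) (𝕜 := ℝ) (E := E) (F := ℝ) 0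
      ).toContinuousLinearEquiv.hasFDerivAt.comp z hα.hasFDerivAt
  rw [extDeriv, h.fderiv, ContinuousAlternatingMap.alternatizeUncurryFin_apply]
  simp [Fin.sum_univ_two, Fin.removeNth, sub_eq_add_neg]

theorem extD_congr {τ τ' : OneForm E M} {x : M}
    (h : chartForm τ x =ᶠ[𝓝 (extChartAt 𝓘(ℝ, E) x x)] chartForm τ' x) :
    extD τ x = extD τ' x := by
  funext u v
  rw [extD, extD, localForm_eq, localForm_eq]
  rw [Filter.EventuallyEq.extDeriv_eq]
  filter_upwards [h] with z hz
  rw [hz]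

theorem tendsto_extChartAt_symm (x : M) :
    Filter.Tendsto (extChartAt 𝓘(ℝ, E) x).symm (𝓝 (extChartAt 𝓘(ℝ, E) x x)) (𝓝 x) := by
  have := continuousAt_extChartAt_symm (I := 𝓘(ℝ, E)) x
  rwa [ContinuousAt, extChartAt_to_inv] at this

theorem chartForm_eventuallyEq {τ τ' : OneForm E M} {x : M} (h : ∀ᶠ y in 𝓝 x, τ y = τ' y) :
    chartForm τ x =ᶠ[𝓝 (extChartAt 𝓘(ℝ, E) x x)] chartForm τ' x := by
  filter_upwards [(tendsto_extChartAt_symm x).eventually h] with z hz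
  rw [chartForm, chartForm, hz]

theorem mdifferentiableAt_extChartAt_symm_of_mem [IsManifold 𝓘(ℝ, E) ∞ M] (x : M) {z : E}
    (hz : z ∈ (extChartAt 𝓘(ℝ, E) x).target) :
    MDifferentiableAt 𝓘(ℝ, E) 𝓘(ℝ, E) (extChartAt 𝓘(ℝ, E) x).symm z := by
  have := mdifferentiableWithinAt_extChartAt_symm (I := 𝓘(ℝ, E)) (x := x) hz
  simpa [mdifferentiableWithinAt_univ] using this

variable [IsManifold 𝓘(ℝ, E) ∞ M]

/-- The trivialization of the tangent bundle at `x` is inverted by the derivative of the inverse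
chart, so near the base point the bundle coordinates of `τ` are exactly `chartForm τ x`. -/
theorem smoothFormAt_iff {τ : OneForm E M} {x : M} :
    SmoothFormAt τ x ↔ ContMDiffAt 𝓘(ℝ, E) (𝓘(ℝ, E).prod 𝓘(ℝ, E →L[ℝ] ℝ)) ∞
    (fun x : M => Bundle.TotalSpace.mk' (E →L[ℝ] ℝ)
      (E := fun y : M => (TangentSpace 𝓘(ℝ, E) y →L[ℝ] ℝ)) x (τ x)) x := by
  rw [contMDiffAt_hom_bundle]
  change _ ↔ ContMDiffAt 𝓘(ℝ, E) 𝓘(ℝ, E) ∞ id x ∧ _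
  rw [and_iff_right contMDiffAt_id, contMDiffAt_iff_source]
  simp only [modelWithCornersSelf_coe, Set.range_id, contMDiffWithinAt_univ,
    contMDiffAt_iff_contDiffAt]
  suffices h : chartForm τ x =ᶠ[𝓝 (extChartAt 𝓘(ℝ, E) x x)] _ from
    ⟨fun h' => h'.congr_of_eventuallyEq h.symm, fun h' => h'.congr_of_eventuallyEq h⟩
  filter_upwards [extChartAt_target_mem_nhds (I := 𝓘(ℝ, E)) x] with z hz
  have hz' : (extChartAt 𝓘(ℝ, E) x).symm z ∈ (chartAt E x).source := by
    simpa using (extChartAt 𝓘(ℝ, E) x).map_target hz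
  simp only [Function.comp_apply, ContinuousLinearMap.inCoordinates,
    TangentBundle.symmL_trivializationAt hz',
    modelWithCornersSelf_coe, Set.range_id, mfderivWithin_univ]
  -- The derivative is taken at the chart image of `symm z`, which equals `z` only propositionally;
  -- tangent spaces depend on the point, so the equality is passed through a variable.
  have h : ∀ z', z' = z → (mfderiv 𝓘(ℝ, E) 𝓘(ℝ, E) (extChartAt 𝓘(ℝ, E) x).symm z' : E →L[ℝ] E) =
      mfderiv 𝓘(ℝ, E) 𝓘(ℝ, E) (extChartAt 𝓘(ℝ, E) x).symm z := by
    rintro _ rfl; rfl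
  ext v
  have h' := DFunLike.congr_fun (h (extChartAt 𝓘(ℝ, E) x ((extChartAt 𝓘(ℝ, E) x).symm z))
    ((extChartAt 𝓘(ℝ, E) x).right_inv hz)) v
  have h'' := congrArg (τ ((extChartAt 𝓘(ℝ, E) x).symm z) : E →L[ℝ] ℝ) h'
  simpa [chartForm] using! h''.symm

/-- The chart at `x` has identity derivative at `x`, so `u` and `v` enter unchanged. -/
theorem extD_apply {τ : OneForm E M} {x : M} (hτ : SmoothFormAt τ x) (u v : E) :
    extD τ x u v = fderiv ℝ (chartForm τ x) (extChartAt 𝓘(ℝ, E) x x) u v -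
      fderiv ℝ (chartForm τ x) (extChartAt 𝓘(ℝ, E) x x) v u := by
  have : IsManifold 𝓘(ℝ, E) 1 M := .of_le (n := ∞) (by simp)
  unfold extD
  rw [localForm_eq, mfderiv_extChartAt_self]
  exact extDeriv_ofSubsingleton (ContDiffAt.differentiableAt hτ (by simp)) _ _

theorem smoothFormOn_iff {τ : OneForm E M} {O : Set M} (hO : IsOpen O) :
    SmoothFormOn τ O ↔ ∀ x ∈ O, SmoothFormAt τ x := by
  refine ⟨fun h x hx => smoothFormAt_iff.2 (h.contMDiffAt (hO.mem_nhds hx)),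
    fun h x hx => (smoothFormAt_iff.1 (h x hx)).contMDiffWithinAt⟩

end ChartForms

/-! ### Pull-backs, differentials of functions, and the Leibniz rule. -/

section Pullback

variable {E : Type*} [NormedAddCommGroup E] [NormedSpace ℝ E]
  {M : Type*} [TopologicalSpace M] [ChartedSpace E M] [IsManifold 𝓘(ℝ, E) ∞ M]
  {E' : Type*} [NormedAddCommGroup E'] [NormedSpace ℝ E']
  {N : Type*} [TopologicalSpace N] [ChartedSpace E' N] [IsManifold 𝓘(ℝ, E') ∞ N]

/-- The pull-back of a 1-form. -/
def pullback (φ : M → N) (τ : OneForm E' N) : OneForm E M := fun x =>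
  (τ (φ x)).comp (mfderiv 𝓘(ℝ, E) 𝓘(ℝ, E') φ x)

/-- The differential of a function, as a 1-form. -/
def dForm (f : M → ℝ) : OneForm E M := fun x => mfderiv 𝓘(ℝ, E) 𝓘(ℝ, ℝ) f x

variable (E E') in
/-- The map `φ` in the charts at `x` and `φ x`. -/
def chartMap (φ : M → N) (x : M) : E → E' :=
  extChartAt 𝓘(ℝ, E') (φ x) ∘ φ ∘ (extChartAt 𝓘(ℝ, E) x).symm

omit [IsManifold 𝓘(ℝ, E) ∞ M] [IsManifold 𝓘(ℝ, E') ∞ N] in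
theorem contDiffAt_chartMap {φ : M → N} {x : M}
    (hφ : ContMDiffAt 𝓘(ℝ, E) 𝓘(ℝ, E') ∞ φ x) :
    ContDiffAt ℝ ∞ (chartMap E E' φ x) (extChartAt 𝓘(ℝ, E) x x) := by
  have := (contMDiffAt_iff.1 hφ).2
  simpa only [modelWithCornersSelf_coe, Set.range_id, contDiffWithinAt_univ] using! this

omit [IsManifold 𝓘(ℝ, E) ∞ M] [IsManifold 𝓘(ℝ, E') ∞ N] in
theorem chartMap_self (φ : M → N) (x : M) :
    chartMap E E' φ x (extChartAt 𝓘(ℝ, E) x x) = extChartAt 𝓘(ℝ, E') (φ x) (φ x) := by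
  simp [chartMap]

omit [IsManifold 𝓘(ℝ, E) ∞ M] in
theorem oneForm_apply_of_eq (τ : OneForm E M) {x y : M} (h : x = y) (v : E) :
    (τ x : E →L[ℝ] ℝ) v = (τ y : E →L[ℝ] ℝ) v := by
  subst h; rfl

/-- The chain rule on both sides of the identity `symm ∘ chartMap = φ ∘ symm`, valid near `z`. -/
theorem mfderiv_chartMap {φ : M → N} (hφ : ContMDiff 𝓘(ℝ, E) 𝓘(ℝ, E') ∞ φ) (x : M) {z : E}
    (hz : z ∈ (extChartAt 𝓘(ℝ, E) x).target)
    (hz' : φ ((extChartAt 𝓘(ℝ, E) x).symm z) ∈ (extChartAt 𝓘(ℝ, E') (φ x)).source) (v : E) :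
    (mfderiv (M := E') 𝓘(ℝ, E') 𝓘(ℝ, E') (extChartAt 𝓘(ℝ, E') (φ x)).symm (chartMap E E' φ x z) : E' →L[ℝ] E')
      (fderiv ℝ (chartMap E E' φ x) z v) =
    (mfderiv 𝓘(ℝ, E) 𝓘(ℝ, E') φ ((extChartAt 𝓘(ℝ, E) x).symm z) : E →L[ℝ] E')
      ((mfderiv 𝓘(ℝ, E) 𝓘(ℝ, E) (extChartAt 𝓘(ℝ, E) x).symm z : E →L[ℝ] E) v) := by
  have h1 := mdifferentiableAt_extChartAt_symm_of_mem x hz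
  have h2 : MDifferentiableAt 𝓘(ℝ, E) 𝓘(ℝ, E') φ ((extChartAt 𝓘(ℝ, E) x).symm z) :=
    (hφ _).mdifferentiableAt (by simp)
  have h3 : MDifferentiableAt 𝓘(ℝ, E') 𝓘(ℝ, E') (extChartAt 𝓘(ℝ, E') (φ x))
      (φ ((extChartAt 𝓘(ℝ, E) x).symm z)) := mdifferentiableAt_extChartAt (by simpa using hz')
  have h4 : MDifferentiableAt 𝓘(ℝ, E) 𝓘(ℝ, E') (chartMap E E' φ x) z :=
    h3.comp z (h2.comp z h1)
  have h5 := mdifferentiableAt_extChartAt_symm_of_mem (φ x) (z := chartMap E E' φ x z)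
    ((extChartAt 𝓘(ℝ, E') (φ x)).map_source hz')
  have e1 := mfderiv_comp z h5 h4
  have e2 := mfderiv_comp z h2 h1
  have e3 : (extChartAt 𝓘(ℝ, E') (φ x)).symm ∘ chartMap E E' φ x =ᶠ[𝓝 z]
      φ ∘ (extChartAt 𝓘(ℝ, E) x).symm := by
    have hc : ContinuousAt (φ ∘ (extChartAt 𝓘(ℝ, E) x).symm) z :=
      (h2.comp z h1).continuousAt
    filter_upwards [hc.preimage_mem_nhds
      ((isOpen_extChartAt_source (I := 𝓘(ℝ, E')) (φ x)).mem_nhds hz')] with w hw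
    exact (extChartAt 𝓘(ℝ, E') (φ x)).left_inv hw
  have e4 := e3.mfderiv_eq (I := 𝓘(ℝ, E)) (I' := 𝓘(ℝ, E'))
  rw [mfderiv_eq_fderiv] at e1
  have l1 := DFunLike.congr_fun e1 v
  have l2 := DFunLike.congr_fun e2 v
  have l4 : mfderiv 𝓘(ℝ, E) 𝓘(ℝ, E') ((extChartAt 𝓘(ℝ, E') (φ x)).symm ∘ chartMap E E' φ x) z v =
    mfderiv 𝓘(ℝ, E) 𝓘(ℝ, E') (φ ∘ (extChartAt 𝓘(ℝ, E) x).symm) z v := by rw [e4]; rfl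
  exact l1.symm.trans (l4.trans l2)

theorem chartForm_pullback {φ : M → N} (hφ : ContMDiff 𝓘(ℝ, E) 𝓘(ℝ, E') ∞ φ)
    (τ : OneForm E' N) (x : M) :
    chartForm (pullback φ τ) x =ᶠ[𝓝 (extChartAt 𝓘(ℝ, E) x x)]
      fun z => (chartForm τ (φ x) (chartMap E E' φ x z)).comp (fderiv ℝ (chartMap E E' φ x) z) := by
  have hc := hφ.continuous.continuousAt.tendsto.comp (tendsto_extChartAt_symm (E := E) x)
  filter_upwards [extChartAt_target_mem_nhds (I := 𝓘(ℝ, E)) x,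
    hc (extChartAt_source_mem_nhds (I := 𝓘(ℝ, E')) (φ x))] with z hz hz'
  ext v
  have h := mfderiv_chartMap hφ x hz hz' v
  have h' : (extChartAt 𝓘(ℝ, E') (φ x)).symm (chartMap E E' φ x z) =
    φ ((extChartAt 𝓘(ℝ, E) x).symm z) := (extChartAt 𝓘(ℝ, E') (φ x)).left_inv hz'
  change (τ (φ ((extChartAt 𝓘(ℝ, E) x).symm z)) : E' →L[ℝ] ℝ) _ =
    (τ ((extChartAt 𝓘(ℝ, E') (φ x)).symm (chartMap E E' φ x z)) : E' →L[ℝ] ℝ)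
      ((mfderiv (M := E') 𝓘(ℝ, E') 𝓘(ℝ, E') (extChartAt 𝓘(ℝ, E') (φ x)).symm (chartMap E E' φ x z) : E' →L[ℝ] E')
      (fderiv ℝ (chartMap E E' φ x) z v))
  exact (congrArg _ h.symm).trans (oneForm_apply_of_eq τ h' _).symm

theorem smoothFormAt_pullback {φ : M → N} (hφ : ContMDiff 𝓘(ℝ, E) 𝓘(ℝ, E') ∞ φ)
    {τ : OneForm E' N} {x : M} (hτ : SmoothFormAt τ (φ x)) :
    SmoothFormAt (pullback (E := E) φ τ) x := by
  refine ContDiffAt.congr_of_eventuallyEq ?_ (chartForm_pullback hφ τ x)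
  have h := contDiffAt_chartMap (hφ x)
  refine ContDiffAt.clm_comp ?_ (h.fderiv_right (by simp))
  refine ContDiffAt.comp (g := chartForm τ (φ x)) _ ?_ h
  rw [chartMap_self]
  exact hτ

omit [IsManifold 𝓘(ℝ, E) ∞ M] [IsManifold 𝓘(ℝ, E') ∞ N] in
theorem mfderiv_eq_fderiv_chartMap {φ : M → N} (hφ : ContMDiff 𝓘(ℝ, E) 𝓘(ℝ, E') ∞ φ) (x : M) :
    (mfderiv 𝓘(ℝ, E) 𝓘(ℝ, E') φ x : E →L[ℝ] E') =
      fderiv ℝ (chartMap E E' φ x) (extChartAt 𝓘(ℝ, E) x x) := by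
  have h : MDifferentiableAt 𝓘(ℝ, E) 𝓘(ℝ, E') φ x := (hφ x).mdifferentiableAt (by simp)
  rw [h.mfderiv, modelWithCornersSelf_coe, Set.range_id, fderivWithin_univ]
  rfl

/-- The product rule also produces `α (D²f(u, v))`, which is symmetric in `u`, `v` and cancels in
the difference. This is why `d` commutes with pull-back. -/
theorem fderiv_pullback_sub {f : E → E'} {α : E' → E' →L[ℝ] ℝ} {z : E}
    (hf : ContDiffAt ℝ ∞ f z) (hα : DifferentiableAt ℝ α (f z)) (u v : E) :
    fderiv ℝ (fun z => (α (f z)).comp (fderiv ℝ f z)) z u v -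
      fderiv ℝ (fun z => (α (f z)).comp (fderiv ℝ f z)) z v u =
    fderiv ℝ α (f z) (fderiv ℝ f z u) (fderiv ℝ f z v) -
      fderiv ℝ α (f z) (fderiv ℝ f z v) (fderiv ℝ f z u) := by
  have hd : DifferentiableAt ℝ f z := hf.differentiableAt (by simp)
  have hd2 : DifferentiableAt ℝ (fderiv ℝ f) z :=
    (hf.fderiv_right (m := ∞) (by simp)).differentiableAt (by simp)
  have hs : fderiv ℝ (fderiv ℝ f) z u v = fderiv ℝ (fderiv ℝ f) z v u :=
    hf.isSymmSndFDerivAt (by simp; exact WithTop.coe_le_coe.2 (le_top : (2 : ℕ∞) ≤ ⊤)) u v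
  have hcomp : HasFDerivAt (fun z => α (f z)) _ z := hα.hasFDerivAt.comp _ hd.hasFDerivAt
  rw [(hcomp.clm_comp hd2.hasFDerivAt).fderiv]
  simp [hs]

theorem extD_pullback {φ : M → N} (hφ : ContMDiff 𝓘(ℝ, E) 𝓘(ℝ, E') ∞ φ)
    {τ : OneForm E' N} {x : M} (hτ : SmoothFormAt τ (φ x)) (u v : TangentSpace 𝓘(ℝ, E) x) :
    extD (pullback φ τ) x u v =
      extD τ (φ x) (mfderiv 𝓘(ℝ, E) 𝓘(ℝ, E') φ x u) (mfderiv 𝓘(ℝ, E) 𝓘(ℝ, E') φ x v) := by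
  have hu := DFunLike.congr_fun (mfderiv_eq_fderiv_chartMap hφ x) u
  have hv := DFunLike.congr_fun (mfderiv_eq_fderiv_chartMap hφ x) v
  refine Eq.trans (extD_apply (smoothFormAt_pullback hφ hτ) u v)
    (Eq.trans ?_ (extD_apply hτ (mfderiv 𝓘(ℝ, E) 𝓘(ℝ, E') φ x u)
      (mfderiv 𝓘(ℝ, E) 𝓘(ℝ, E') φ x v)).symm)
  have hτd : DifferentiableAt ℝ (chartForm τ (φ x))
      (chartMap E E' φ x (extChartAt 𝓘(ℝ, E) x x)) := by
    rw [chartMap_self]; exact ContDiffAt.differentiableAt hτ (by simp)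
  have key := fderiv_pullback_sub (contDiffAt_chartMap (hφ x)) hτd u v
  rw [(chartForm_pullback hφ τ x).fderiv_eq]
  refine Eq.trans key ?_
  rw [chartMap_self]
  exact congrArg₂ (fun a b : E' =>
    fderiv ℝ (chartForm τ (φ x)) (extChartAt 𝓘(ℝ, E') (φ x) (φ x)) a b -
      fderiv ℝ (chartForm τ (φ x)) (extChartAt 𝓘(ℝ, E') (φ x) (φ x)) b a) hu.symm hv.symm

theorem chartForm_dForm {f : M → ℝ} {x : M}
    (hf : ContMDiffAt 𝓘(ℝ, E) 𝓘(ℝ, ℝ) ∞ f x) :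
    chartForm (dForm (E := E) f) x =ᶠ[𝓝 (extChartAt 𝓘(ℝ, E) x x)]
      fderiv ℝ (f ∘ (extChartAt 𝓘(ℝ, E) x).symm) := by
  have h1 : ∀ᶠ y in 𝓝 x, MDifferentiableAt 𝓘(ℝ, E) 𝓘(ℝ, ℝ) f y := by
    have : IsManifold 𝓘(ℝ, E) 1 M := .of_le (n := ∞) (by simp)
    exact ((contMDiffAt_iff_contMDiffAt_nhds (by simp)).1 (hf.of_le (m := 1) (by simp))).mono
      fun y hy => hy.mdifferentiableAt one_ne_zero
  filter_upwards [extChartAt_target_mem_nhds (I := 𝓘(ℝ, E)) x,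
    (tendsto_extChartAt_symm x).eventually h1] with z hz hz'
  rw [← mfderiv_eq_fderiv, mfderiv_comp z hz' (mdifferentiableAt_extChartAt_symm_of_mem x hz)]
  rfl

omit [IsManifold 𝓘(ℝ, E) ∞ M] in
theorem contDiffAt_comp_symm {f : M → ℝ} {x : M}
    (hf : ContMDiffAt 𝓘(ℝ, E) 𝓘(ℝ, ℝ) ∞ f x) :
    ContDiffAt ℝ ∞ (f ∘ (extChartAt 𝓘(ℝ, E) x).symm) (extChartAt 𝓘(ℝ, E) x x) := by
  have := (contMDiffAt_iff.1 hf).2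
  simpa only [modelWithCornersSelf_coe, Set.range_id, contDiffWithinAt_univ] using! this

omit [IsManifold 𝓘(ℝ, E) ∞ M] in
theorem dForm_apply {f : M → ℝ} {x : M} (hf : ContMDiffAt 𝓘(ℝ, E) 𝓘(ℝ, ℝ) ∞ f x) (v : E) :
    dForm (E := E) f x v =
      fderiv ℝ (f ∘ (extChartAt 𝓘(ℝ, E) x).symm) (extChartAt 𝓘(ℝ, E) x x) v := by
  have h : MDifferentiableAt 𝓘(ℝ, E) 𝓘(ℝ, ℝ) f x := hf.mdifferentiableAt (by simp)
  rw [dForm, h.mfderiv, modelWithCornersSelf_coe, Set.range_id, fderivWithin_univ]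
  rfl

theorem chartForm_self (τ : OneForm E M) (x : M) (v : E) :
    chartForm τ x (extChartAt 𝓘(ℝ, E) x x) v = τ x v := by
  have : IsManifold 𝓘(ℝ, E) 1 M := .of_le (n := ∞) (by simp)
  have h := mfderivWithin_range_extChartAt_symm (I := 𝓘(ℝ, E)) (x := x)
  rw [modelWithCornersSelf_coe, Set.range_id, mfderivWithin_univ] at h
  have h' : (mfderiv 𝓘(ℝ, E) 𝓘(ℝ, E) (extChartAt 𝓘(ℝ, E) x).symm (extChartAt 𝓘(ℝ, E) x x) v : E)
    = v := DFunLike.congr_fun h v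
  exact (oneForm_apply_of_eq τ (extChartAt_to_inv x) _).trans (congrArg _ h')

theorem smoothFormAt_dForm {f : M → ℝ} {x : M} (hf : ContMDiffAt 𝓘(ℝ, E) 𝓘(ℝ, ℝ) ∞ f x) :
    SmoothFormAt (dForm (E := E) f) x :=
  ContDiffAt.congr_of_eventuallyEq ((contDiffAt_comp_symm hf).fderiv_right (by simp))
    (chartForm_dForm hf)

theorem extD_dForm {f : M → ℝ} {x : M} (hf : ContMDiffAt 𝓘(ℝ, E) 𝓘(ℝ, ℝ) ∞ f x)
    (u v : TangentSpace 𝓘(ℝ, E) x) : extD (dForm (E := E) f) x u v = 0 := by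
  refine (extD_apply (smoothFormAt_dForm hf) u v).trans ?_
  rw [(chartForm_dForm hf).fderiv_eq, sub_eq_zero]
  exact (contDiffAt_comp_symm hf).isSymmSndFDerivAt (by simp; exact WithTop.coe_le_coe.2 (le_top : (2 : ℕ∞) ≤ ⊤)) u v

omit [IsManifold 𝓘(ℝ, E) ∞ M] in
theorem chartForm_sum_smul {ι : Type*} [Fintype ι] (c : ι → M → ℝ) (β : ι → OneForm E M) (x : M) :
    chartForm (fun y => ∑ i, c i y • β i y) x =
      fun z => ∑ i, (c i ∘ (extChartAt 𝓘(ℝ, E) x).symm) z • chartForm (β i) x z := by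
  funext z
  ext v
  refine Eq.trans (sum_apply (F := E →L[ℝ] ℝ) Finset.univ (fun i =>
    c i ((extChartAt 𝓘(ℝ, E) x).symm z) • β i ((extChartAt 𝓘(ℝ, E) x).symm z))
    (mfderiv 𝓘(ℝ, E) 𝓘(ℝ, E) (extChartAt 𝓘(ℝ, E) x).symm z v)) ?_
  exact (sum_apply (F := E →L[ℝ] ℝ) (Finset.univ : Finset ι) (fun i =>
    (c i ∘ (extChartAt 𝓘(ℝ, E) x).symm) z • chartForm (β i) x z) v).symm

theorem extD_sum_smul {ι : Type*} [Fintype ι] {c : ι → M → ℝ} {β : ι → OneForm E M} {x : M}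
    (hc : ∀ i, ContMDiffAt 𝓘(ℝ, E) 𝓘(ℝ, ℝ) ∞ (c i) x) (hβ : ∀ i, SmoothFormAt (β i) x)
    (u v : TangentSpace 𝓘(ℝ, E) x) :
    extD (fun y => ∑ i, c i y • β i y) x u v =
      ∑ i, (dForm (E := E) (c i) x u * β i x v - dForm (E := E) (c i) x v * β i x u
        + c i x * extD (β i) x u v) := by
  have hs : SmoothFormAt (fun y => ∑ i, c i y • β i y) x := by
    rw [SmoothFormAt, chartForm_sum_smul]
    exact ContDiffAt.sum fun i _ => (contDiffAt_comp_symm (hc i)).smul (hβ i)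
  revert u v
  change ∀ u v : E, _
  intro u v
  refine (extD_apply hs u v).trans ?_
  have hd : ∀ i, HasFDerivAt
      (fun z => (c i ∘ (extChartAt 𝓘(ℝ, E) x).symm) z • chartForm (β i) x z) _ _ := fun i =>
    ((contDiffAt_comp_symm (hc i)).differentiableAt (by simp)).hasFDerivAt.smul
      (ContDiffAt.differentiableAt (hβ i) (by simp)).hasFDerivAt
  rw [chartForm_sum_smul, (HasFDerivAt.fun_sum fun i _ => hd i).fderiv]
  simp only [sum_apply, ← Finset.sum_sub_distrib]
  refine Finset.sum_congr rfl fun i _ => ?_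
  rw [Eq.trans (extD_apply (hβ i) u v) rfl]
  have h1 := fun w => dForm_apply (hc i) w
  have h2 := fun w => chartForm_self (β i) x w
  have h3 : (c i ∘ (extChartAt 𝓘(ℝ, E) x).symm) (extChartAt 𝓘(ℝ, E) x x) = c i x := by simp
  rw [h1, h1, ← h2, ← h2, h3]
  simp only [add_apply, smul_apply,
    ContinuousLinearMap.smulRight_apply, smul_eq_mul]
  ring

end Pullback

/-! ### Local independence and smooth coefficients. -/

section Frames

variable {E : Type*} [NormedAddCommGroup E] [NormedSpace ℝ E]
  {M : Type*} [TopologicalSpace M] [ChartedSpace E M] [IsManifold 𝓘(ℝ, E) ∞ M]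

omit [IsManifold 𝓘(ℝ, E) ∞ M] in
theorem eventually_of_eventually_extChartAt_symm {x : M} {p : M → Prop}
    (h : ∀ᶠ z in 𝓝 (extChartAt 𝓘(ℝ, E) x x), p ((extChartAt 𝓘(ℝ, E) x).symm z)) :
    ∀ᶠ y in 𝓝 x, p y := by
  filter_upwards [(continuousAt_extChartAt (I := 𝓘(ℝ, E)) x).eventually h,
    extChartAt_source_mem_nhds (I := 𝓘(ℝ, E)) x] with y hy hy'
  rwa [(extChartAt 𝓘(ℝ, E) x).left_inv hy'] at hy

theorem chartForm_self_eq (τ : OneForm E M) (x : M) :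
    chartForm τ x (extChartAt 𝓘(ℝ, E) x x) = (τ x : E →L[ℝ] ℝ) :=
  ContinuousLinearMap.ext fun v => chartForm_self τ x v

/-- Independence is an open condition in the fixed space `E →L[ℝ] ℝ`. It descends from `chartForm`
to the forms because `chartForm` is their image under a linear map, composition with the derivative
of the inverse chart. -/
theorem eventually_linearIndependent {ι : Type*} [Finite ι] {β : ι → OneForm E M} {x : M}
    (hβ : ∀ i, SmoothFormAt (β i) x) (hx : LinearIndependent ℝ fun i => β i x) :
    ∀ᶠ y in 𝓝 x, LinearIndependent ℝ fun i => β i y := by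
  apply eventually_of_eventually_extChartAt_symm (E := E)
  have hc : ContinuousAt (fun z => fun i => chartForm (β i) x z) (extChartAt 𝓘(ℝ, E) x x) :=
    continuousAt_pi.2 fun i => ContDiffAt.continuousAt (hβ i)
  have h0 : LinearIndependent ℝ fun i => chartForm (β i) x (extChartAt 𝓘(ℝ, E) x x) := by
    simpa only [chartForm_self_eq] using! hx
  filter_upwards [hc.eventually h0.eventually] with z hz
  exact LinearIndependent.of_comp
    (((ContinuousLinearMap.compL ℝ E E ℝ).flip
      (mfderiv 𝓘(ℝ, E) 𝓘(ℝ, E) (extChartAt 𝓘(ℝ, E) x).symm z)).toLinearMap) hz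

omit [IsManifold 𝓘(ℝ, E) ∞ M] in
theorem chartForm_eq_sum {ι : Type*} [Fintype ι] {c : ι → M → ℝ} {α : OneForm E M}
    {β : ι → OneForm E M} {x : M} {z : E}
    (h : α ((extChartAt 𝓘(ℝ, E) x).symm z) =
      ∑ i, c i ((extChartAt 𝓘(ℝ, E) x).symm z) • β i ((extChartAt 𝓘(ℝ, E) x).symm z)) :
    chartForm α x z = ∑ i, c i ((extChartAt 𝓘(ℝ, E) x).symm z) • chartForm (β i) x z := by
  refine Eq.trans ?_ (congrFun (chartForm_sum_smul c β x) z)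
  rw [chartForm, h]
  rfl

/-- Let `L w` send coefficients to combinations of the `β i w`, and let `P` be a left inverse of `L
z`. Then `P ∘ L w` is the identity at `w = z`, hence invertible nearby, and `c = (P ∘ L)⁻¹ (P α)` is
smooth because inversion is. -/
theorem contDiffAt_coefficients {ι : Type*} [Fintype ι]
    {F : Type*} [NormedAddCommGroup F] [NormedSpace ℝ F] [FiniteDimensional ℝ F]
    {α : E → F} {β : ι → E → F} {c : ι → E → ℝ} {z : E}
    (hα : ContDiffAt ℝ ∞ α z) (hβ : ∀ i, ContDiffAt ℝ ∞ (β i) z)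
    (hz : LinearIndependent ℝ fun i => β i z)
    (h : ∀ᶠ w in 𝓝 z, α w = ∑ i, c i w • β i w) (i : ι) :
    ContDiffAt ℝ ∞ (c i) z := by
  classical
  let L : E → (ι → ℝ) →L[ℝ] F := fun w =>
    ∑ i, (ContinuousLinearMap.proj (R := ℝ) (φ := fun _ : ι => ℝ) i).smulRight (β i w)
  have hLa : ∀ w a, L w a = ∑ i, a i • β i w := fun w a => by simp [L, sum_apply]
  have hL : ContDiffAt ℝ ∞ L z := ContDiffAt.sum fun i _ =>
    contDiffAt_const.smulRight (hβ i)
  have hinj : LinearMap.ker (L z).toLinearMap = ⊥ := by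
    rw [LinearMap.ker_eq_bot']
    intro a ha
    funext j
    exact Fintype.linearIndependent_iff.1 hz a ((hLa z a).symm.trans ha) j
  obtain ⟨P, hP⟩ := LinearMap.exists_leftInverse_of_injective _ hinj
  let P' : F →L[ℝ] (ι → ℝ) := LinearMap.toContinuousLinearMap P
  let A : E → (ι → ℝ) →L[ℝ] (ι → ℝ) := fun w => P'.comp (L w)
  have hA : ContDiffAt ℝ ∞ A z := contDiffAt_const.clm_comp hL
  have hA1 : A z = 1 := by
    ext1 a
    exact DFunLike.congr_fun hP a
  have hg : ContDiffAt ℝ ∞ (fun w => Ring.inverse (A w) (P' (α w))) z := by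
    refine ContDiffAt.clm_apply ?_ (P'.contDiff.contDiffAt.comp z hα)
    refine ContDiffAt.comp (g := Ring.inverse) z ?_ hA
    rw [hA1]
    exact contDiffAt_ringInverse ℝ (1 : ((ι → ℝ) →L[ℝ] (ι → ℝ))ˣ)
  have hu : ∀ᶠ w in 𝓝 z, IsUnit (A w) := by
    refine hA.continuousAt.eventually ?_
    rw [hA1]
    exact Units.isOpen.mem_nhds isUnit_one
  refine (contDiffAt_pi.1 hg i).congr_of_eventuallyEq ?_
  filter_upwards [h, hu] with w hw hw'
  have h1 : P' (α w) = A w fun i => c i w := by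
    rw [hw, ← hLa w fun i => c i w]; rfl
  rw [h1]
  have h2 := DFunLike.congr_fun (Ring.inverse_mul_cancel _ hw') fun i => c i w
  exact (congrFun h2 i).symm

theorem exists_smooth_coefficients [FiniteDimensional ℝ E] {ι : Type*} [Fintype ι]
    {O : Set M} (hO : IsOpen O) {α : OneForm E M} {β : ι → OneForm E M}
    (hα : ∀ y ∈ O, SmoothFormAt α y) (hβ : ∀ y ∈ O, ∀ i, SmoothFormAt (β i) y)
    (hi : ∀ y ∈ O, LinearIndependent ℝ fun i => β i y)
    (hs : ∀ y ∈ O, α y ∈ Submodule.span ℝ (Set.range fun i => β i y)) :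
    ∃ c : ι → M → ℝ, (∀ y ∈ O, ∀ i, ContMDiffAt 𝓘(ℝ, E) 𝓘(ℝ, ℝ) ∞ (c i) y) ∧
      ∀ y ∈ O, α y = ∑ i, c i y • β i y := by
  have h : ∀ y, ∃ a : ι → ℝ, y ∈ O → α y = ∑ i, a i • β i y := fun y => by
    by_cases hy : y ∈ O
    · obtain ⟨a, ha⟩ := (Submodule.mem_span_range_iff_exists_fun ℝ).1 (hs y hy)
      exact ⟨a, fun _ => ha.symm⟩
    · exact ⟨0, fun h => absurd h hy⟩
  choose a ha using h
  refine ⟨fun i y => a y i, fun x hx i => ?_, ha⟩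
  have h0 : LinearIndependent ℝ fun i => chartForm (β i) x (extChartAt 𝓘(ℝ, E) x x) := by
    simpa only [chartForm_self_eq] using! hi x hx
  have key : ContDiffAt ℝ ∞ (fun z => a ((extChartAt 𝓘(ℝ, E) x).symm z) i)
      (extChartAt 𝓘(ℝ, E) x x) := by
    refine contDiffAt_coefficients (hα x hx) (hβ x hx) h0
      (c := fun i z => a ((extChartAt 𝓘(ℝ, E) x).symm z) i) ?_ i
    filter_upwards [(tendsto_extChartAt_symm x).eventually (hO.mem_nhds hx)] with z hz
    exact chartForm_eq_sum (c := fun i y => a y i) (ha _ hz)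
  rw [contMDiffAt_iff_source]
  simpa only [modelWithCornersSelf_coe, Set.range_id, contMDiffWithinAt_univ,
    contMDiffAt_iff_contDiffAt] using! key

end Frames

/-! ### Membership in the maximal integrable subsystem. -/

section Integrable

variable {E : Type*} [NormedAddCommGroup E] [NormedSpace ℝ E]
  {M : Type*} [TopologicalSpace M] [ChartedSpace E M] [IsManifold 𝓘(ℝ, E) ∞ M]

theorem derivedInf_le (V : CoDistribution E M) (x : M) : derivedInf V x ≤ V x := by
  refine sSup_le ?_
  rintro _ ⟨O, U, -, hx, -, h, rfl⟩
  exact h x hx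

/-- The span of the `α i` may change rank, so it need not be a subbundle. Rank cannot drop locally,
so about a point of maximal rank it is constant; there the span is an integrable subbundle of `V`.
-/
theorem exists_mem_derivedInf_of_closed {V : CoDistribution E M} {n : ℕ} {α : Fin n → OneForm E M}
    {U : Set M} (hU : IsOpen U) (hne : U.Nonempty) (hα : ∀ y ∈ U, ∀ i, SmoothFormAt (α i) y)
    (hV : ∀ y ∈ U, ∀ i, α i y ∈ V y)
    (hd : ∀ y ∈ U, ∀ i, ∀ u v : TangentSpace 𝓘(ℝ, E) y,
      (∀ j, α j y u = 0) → (∀ j, α j y v = 0) → extD (α i) y u v = 0) :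
    ∃ y ∈ U, ∀ i, α i y ∈ derivedInf V y := by
  classical
  let d : M → ℕ := fun y => Module.finrank ℝ (sp α y)
  have hfin : ∀ y, FiniteDimensional ℝ (sp α y) := fun y =>
    FiniteDimensional.span_of_finite ℝ (Set.finite_range _)
  have hb : ∀ y, d y ≤ n := fun y => by
    simpa using! finrank_range_le_card (R := ℝ) (fun i => α i y)
  obtain ⟨y, hy, hmax⟩ : ∃ y ∈ U, ∀ w ∈ U, d w ≤ d y := by
    have hbdd : BddAbove (d '' U) := ⟨n, by rintro _ ⟨w, -, rfl⟩; exact hb w⟩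
    obtain ⟨y, hy, h⟩ := Nat.sSup_mem (hne.image d) hbdd
    exact ⟨y, hy, fun w hw => h ▸ le_csSup hbdd ⟨w, hw, rfl⟩⟩
  refine ⟨y, hy, ?_⟩
  -- A subfamily forming a basis at `y` stays independent nearby, and maximality of the rank forces
  -- it to keep spanning.
  obtain ⟨κ, a, ha, hspan, hind⟩ := exists_linearIndependent' ℝ (fun i => α i y)
  have : Finite κ := Finite.of_injective a ha
  obtain ⟨m, ⟨e⟩⟩ := Finite.exists_equiv_fin κ
  let f : Fin m → Fin n := a ∘ e.symm
  have hind' : LinearIndependent ℝ fun j => α (f j) y := hind.comp _ e.symm.injective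
  have hm : d y = m := by
    have h1 : sp (fun j => α (f j)) y = sp α y := by
      rw [sp, sp, ← hspan]
      congr 1
      exact e.symm.surjective.range_comp ((fun i => α i y) ∘ a)
    have := finrank_span_eq_card hind'
    change Module.finrank ℝ (sp (fun j => α (f j)) y) = _ at this
    rw [h1] at this
    simpa [d] using this
  obtain ⟨W, hWs, hWo, hyW⟩ := mem_nhds_iff.1 (Filter.inter_mem (hU.mem_nhds hy)
    (eventually_linearIndependent (fun j => hα y hy (f j)) hind'))
  have hspW : ∀ w ∈ W, sp (fun j => α (f j)) w = sp α w := fun w hw => by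
    have h1 := finrank_span_eq_card (hWs hw).2
    refine Submodule.eq_of_le_of_finrank_le ?_ ?_
    · exact Submodule.span_mono (Set.range_comp_subset_range f fun i => α i w)
    · refine (hmax w (hWs hw).1).trans ?_
      rw [hm]
      exact ((Fintype.card_fin m).symm.trans h1.symm).le
  have hmem : ∀ w i, α i w ∈ sp α w := fun w i => Submodule.subset_span ⟨i, rfl⟩
  have hfr : IsFrameOn (sp α) W fun j => α (f j) :=
    ⟨hWo, fun j => (smoothFormOn_iff hWo).2 fun w hw => hα w (hWs hw).1 _,
      fun w hw => (hWs hw).2, hspW⟩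
  have hint : IsIntegrableSubbundleOn (sp α) W := by
    refine ⟨m, fun w hw => ⟨W, _, hw, subset_rfl, hfr, fun z hz j u v hu hv => ?_⟩⟩
    exact hd z (hWs hz).1 _ u v (fun i => hu _ (hmem z i)) (fun i => hv _ (hmem z i))
  intro i
  refine (le_sSup ⟨W, sp α, hWo, hyW, hint, fun w hw => ?_, rfl⟩ : sp α y ≤ derivedInf V y)
    (hmem y i)
  refine Submodule.span_le.2 ?_
  rintro _ ⟨j, rfl⟩
  exact hV w (hWs hw).1 j

/-- Points of maximal rank, taken in arbitrarily small open sets, are dense. If `α i` left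
`derivedInf V` at `x`, then `α i` together with a frame of `derivedInf V` would remain independent
near `x`, contradicting membership at such a point. -/
theorem mem_derivedInf_of_closed {V : CoDistribution E M} {n : ℕ} {α : Fin n → OneForm E M}
    {U : Set M} (hVi : IsIntegrableSubbundleOn (derivedInf V) Set.univ)
    (hU : IsOpen U) (hα : ∀ y ∈ U, ∀ i, SmoothFormAt (α i) y)
    (hV : ∀ y ∈ U, ∀ i, α i y ∈ V y)
    (hd : ∀ y ∈ U, ∀ i, ∀ u v : TangentSpace 𝓘(ℝ, E) y,
      (∀ j, α j y u = 0) → (∀ j, α j y v = 0) → extD (α i) y u v = 0)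
    {x : M} (hx : x ∈ U) (i : Fin n) : α i x ∈ derivedInf V x := by
  by_contra hn
  obtain ⟨m, hm⟩ := hVi
  obtain ⟨W, τ, hxW, -, hτ, -⟩ := hm x trivial
  have hcons : ∀ y, (fun j => (Fin.cons (α i) τ : Fin (m + 1) → OneForm E M) j y) =
      Fin.cons (α i y) fun j => τ j y := fun y => by
    funext j
    refine Fin.cases rfl (fun j => rfl) j
  have hind : LinearIndependent ℝ fun j => (Fin.cons (α i) τ : Fin (m + 1) → OneForm E M) j x := by
    have h := linearIndependent_finCons.2 ⟨hτ.independent x hxW, by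
      change α i x ∉ sp τ x; rwa [hτ.span_eq x hxW]⟩
    rw [hcons]
    exact h
  have hsm : ∀ j, SmoothFormAt ((Fin.cons (α i) τ : Fin (m + 1) → OneForm E M) j) x := by
    refine Fin.cases (hα x hx i) fun j => ?_
    exact (smoothFormOn_iff hτ.isOpen).1 (hτ.smooth j) x hxW
  obtain ⟨U', hU's, hU'o, hxU'⟩ := mem_nhds_iff.1 (Filter.inter_mem
    (Filter.inter_mem (hU.mem_nhds hx) (hτ.isOpen.mem_nhds hxW))
    (eventually_linearIndependent hsm hind))
  obtain ⟨y, hy, h⟩ := exists_mem_derivedInf_of_closed (V := V) (α := α) hU'o ⟨x, hxU'⟩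
    (fun y hy => hα y (hU's hy).1.1) (fun y hy => hV y (hU's hy).1.1)
    (fun y hy => hd y (hU's hy).1.1)
  have h2 : LinearIndependent ℝ fun j => (Fin.cons (α i) τ : Fin (m + 1) → OneForm E M) j y :=
    (hU's hy).2
  rw [hcons] at h2
  refine (linearIndependent_finCons.1 h2).2 ?_
  change α i y ∈ sp τ y
  rw [hτ.span_eq y (hU's hy).1.2]
  exact h i

theorem dForm_mem_derivedInf {V : CoDistribution E M} {f : M → ℝ}
    {U : Set M} (hVi : IsIntegrableSubbundleOn (derivedInf V) Set.univ)
    (hU : IsOpen U) (hf : ∀ y ∈ U, ContMDiffAt 𝓘(ℝ, E) 𝓘(ℝ, ℝ) ∞ f y)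
    (hV : ∀ y ∈ U, dForm f y ∈ V y) {x : M} (hx : x ∈ U) : dForm f x ∈ derivedInf V x :=
  mem_derivedInf_of_closed (α := fun _ : Fin 1 => dForm f) hVi hU
    (fun y hy _ => smoothFormAt_dForm (hf y hy)) (fun y hy _ => hV y hy)
    (fun y hy _ u v _ _ => extD_dForm (hf y hy) u v) hx 0

variable {E' : Type*} [NormedAddCommGroup E'] [NormedSpace ℝ E']
  {N : Type*} [TopologicalSpace N] [ChartedSpace E' N] [IsManifold 𝓘(ℝ, E') ∞ N]

/-- A pulled-back frame can lose rank, but it is still differentially closed, which is all that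
`mem_derivedInf_of_closed` asks for. -/
theorem pullback_mem_derivedInf {V : CoDistribution E M} {W : CoDistribution E' N} {φ : M → N}
    (hφ : ContMDiff 𝓘(ℝ, E) 𝓘(ℝ, E') ∞ φ)
    (hVi : IsIntegrableSubbundleOn (derivedInf V) Set.univ)
    (hWi : IsIntegrableSubbundleOn (derivedInf W) Set.univ)
    (h : ∀ x, ∀ τ ∈ W (φ x), τ.comp (mfderiv 𝓘(ℝ, E) 𝓘(ℝ, E') φ x) ∈ V x)
    (x : M) {τ : TangentSpace 𝓘(ℝ, E') (φ x) →L[ℝ] ℝ} (hτ : τ ∈ derivedInf W (φ x)) :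
    τ.comp (mfderiv 𝓘(ℝ, E) 𝓘(ℝ, E') φ x) ∈ derivedInf V x := by
  obtain ⟨n, hn⟩ := hWi
  obtain ⟨U, α, hxU, -, hα, hd⟩ := hn (φ x) trivial
  have hmem : ∀ y ∈ U, ∀ i, α i y ∈ derivedInf W y := fun y hy i => by
    rw [← hα.span_eq y hy]; exact Submodule.subset_span ⟨i, rfl⟩
  have key : ∀ i, pullback φ (α i) x ∈ derivedInf V x := by
    refine mem_derivedInf_of_closed (α := fun i => pullback φ (α i)) hVi
      (hα.isOpen.preimage hφ.continuous) (fun y hy i => ?_) (fun y hy i => ?_)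
      (fun y hy i u v hu hv => ?_) hxU
    · exact smoothFormAt_pullback hφ ((smoothFormOn_iff hα.isOpen).1 (hα.smooth i) _ hy)
    · exact h y _ (derivedInf_le W _ (hmem _ hy i))
    · rw [extD_pullback hφ ((smoothFormOn_iff hα.isOpen).1 (hα.smooth i) _ hy)]
      -- If the pulled-back forms kill `u`, the frame kills `φ_* u`, hence so does its whole span
      -- `derivedInf W`.
      refine hd _ hy i _ _ (fun β hβ => ?_) (fun β hβ => ?_)
      all_goals
        rw [← hα.span_eq _ hy] at hβ
        induction hβ using Submodule.span_induction with
        | mem β hβ => obtain ⟨j, rfl⟩ := hβ; first | exact hu j | exact hv j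
        | zero => rfl
        | add β γ _ _ h1 h2 => rw [add_apply, h1, h2, add_zero]
        | smul c β _ h1 => rw [smul_apply, h1, smul_zero]
  rw [← hα.span_eq _ hxU] at hτ
  induction hτ using Submodule.span_induction with
  | mem β hβ => obtain ⟨j, rfl⟩ := hβ; exact key j
  | zero => rw [ContinuousLinearMap.zero_comp]; exact Submodule.zero_mem _
  | add β γ _ _ h1 h2 => rw [ContinuousLinearMap.add_comp]; exact Submodule.add_mem _ h1 h2
  | smul c β _ h1 => rw [ContinuousLinearMap.smul_comp]; exact Submodule.smul_mem _ c h1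

end Integrable

/-! ### Vanishing of covectors and wedge products on given vectors. -/

section Annihilators

variable {T : Type*} [AddCommGroup T] [Module ℝ T] [TopologicalSpace T]
  [IsTopologicalAddGroup T] [ContinuousSMul ℝ T]

/-- The covectors that vanish at `v`. -/
def covectorsVanishingAt (v : T) : Submodule ℝ (T →L[ℝ] ℝ) where
  carrier := {α | α v = 0}
  add_mem' {α β} hα hβ := by
    rw [Set.mem_ofPred_eq] at *
    rw [add_apply, hα, hβ, add_zero]
  zero_mem' := rfl
  smul_mem' c α hα := by
    rw [Set.mem_ofPred_eq] at *
    rw [smul_apply, hα, smul_zero]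

omit [IsTopologicalAddGroup T] [ContinuousSMul ℝ T] in
/-- The functions of two vectors that vanish at `(u, v)`. -/
def formsVanishingAt (u v : T) : Submodule ℝ (T → T → ℝ) where
  carrier := {b | b u v = 0}
  add_mem' {a b} ha hb := by
    rw [Set.mem_ofPred_eq] at *
    rw [Pi.add_apply, Pi.add_apply, ha, hb, add_zero]
  zero_mem' := rfl
  smul_mem' c a ha := by
    rw [Set.mem_ofPred_eq] at *
    rw [Pi.smul_apply, Pi.smul_apply, ha, smul_zero]

omit [IsTopologicalAddGroup T] [ContinuousSMul ℝ T] in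
theorem wedgeSpan_le_formsVanishingAt {A B : Submodule ℝ (T →L[ℝ] ℝ)} {u v : T}
    (h : ∀ α ∈ A, ∀ β ∈ B, α u * β v = 0 ∧ α v * β u = 0) :
    wedgeSpan A B ≤ formsVanishingAt u v := by
  refine Submodule.span_le.2 ?_
  rintro _ ⟨α, hα, β, hβ, rfl⟩
  change α u * β v - α v * β u = 0
  rw [(h α hα β hβ).1, (h α hα β hβ).2, sub_zero]

omit [IsTopologicalAddGroup T] [ContinuousSMul ℝ T] in
theorem wedgeSpan_le_of_le {A B : Submodule ℝ (T →L[ℝ] ℝ)} {u v : T}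
    (hA : A ≤ covectorsVanishingAt v) (hB : B ≤ covectorsVanishingAt v) :
    wedgeSpan A B ≤ formsVanishingAt u v :=
  wedgeSpan_le_formsVanishingAt fun α hα β hβ => by
    rw [show α v = 0 from hA hα, show β v = 0 from hB hβ]; simp

theorem mem_of_vanishing {E : Type*} [NormedAddCommGroup E] [NormedSpace ℝ E]
    [FiniteDimensional ℝ E] (V : Submodule ℝ (E →L[ℝ] ℝ)) (α : E →L[ℝ] ℝ)
    (h : ∀ u : E, (∀ β ∈ V, β u = 0) → α u = 0) : α ∈ V := by
  let e : (E →ₗ[ℝ] ℝ) ≃ₗ[ℝ] E →L[ℝ] ℝ := LinearMap.toContinuousLinearMap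
  let V' : Submodule ℝ (Module.Dual ℝ E) := V.comap e.toLinearMap
  have h1 := Subspace.dualCoannihilator_dualAnnihilator_eq (W := V')
  have h2 : e.symm α ∈ V'.dualCoannihilator.dualAnnihilator := by
    rw [Submodule.mem_dualAnnihilator]
    intro u hu
    refine h u fun β hβ => ?_
    rw [Submodule.mem_dualCoannihilator] at hu
    exact hu (e.symm β) (by simpa [V'] using hβ)
  rw [h1] at h2
  simpa [V'] using h2

end Annihilators

/-! ### Vertical vectors and the structure equations. -/

section Coframes

variable {E : Type*} [NormedAddCommGroup E] [NormedSpace ℝ E]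
  {M : Type*} [TopologicalSpace M] [ChartedSpace E M] [IsManifold 𝓘(ℝ, E) ∞ M]
  {Vh Vc : CoDistribution E M}

/-- Tangent vectors annihilated by both `Vh^(∞)` and `Vc^(∞)`. -/
structure IsVertical (Vh Vc : CoDistribution E M) {y : M} (v : TangentSpace 𝓘(ℝ, E) y) :
    Prop where
  hat : derivedInf Vh y ≤ covectorsVanishingAt v
  check : derivedInf Vc y ≤ covectorsVanishingAt v

omit [IsManifold 𝓘(ℝ, E) ∞ M] in
theorem sp_le_covectorsVanishingAt {n : ℕ} {τ : Fin n → OneForm E M} {y : M}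
    {v : TangentSpace 𝓘(ℝ, E) y} (h : ∀ i, τ i y v = 0) : sp τ y ≤ covectorsVanishingAt v := by
  refine Submodule.span_le.2 ?_
  rintro _ ⟨i, rfl⟩
  exact h i

omit [IsManifold 𝓘(ℝ, E) ∞ M] in
theorem mem_sp {n : ℕ} (τ : Fin n → OneForm E M) (y : M) (i : Fin n) : τ i y ∈ sp τ y :=
  Submodule.subset_span ⟨i, rfl⟩

namespace FourAdaptedCoframe

variable (F : FourAdaptedCoframe Vh Vc)

theorem zeroAdapted : IsZeroAdapted Vh Vc F.O F.θX F.σh F.ηh F.σc F.ηc :=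
  F.threeAdapted.twoAdapted_X.toIsZeroAdapted

/-- The coframe `(θX, ηh, ηc)` of `Vh ∩ Vc`. -/
def interForms : Fin F.r ⊕ (Fin F.qh ⊕ Fin F.qc) → OneForm E M :=
  Sum.elim F.θX (Sum.elim F.ηh F.ηc)

theorem smoothFormAt_interForms {y : M} (hy : y ∈ F.O) (i) : SmoothFormAt (F.interForms i) y := by
  have h := F.zeroAdapted
  rcases i with i | i | i
  exacts [(smoothFormOn_iff h.isOpen).1 (h.smooth_θ i) y hy,
    (smoothFormOn_iff h.isOpen).1 (h.smooth_ηh i) y hy,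
    (smoothFormOn_iff h.isOpen).1 (h.smooth_ηc i) y hy]

theorem linearIndependent_interForms {y : M} (hy : y ∈ F.O) :
    LinearIndependent ℝ fun i => F.interForms i y := by
  convert! F.zeroAdapted.indep_hc y hy using 1
  funext i
  rcases i with i | i | i <;> rfl

theorem span_interForms {y : M} (hy : y ∈ F.O) :
    Vh y ⊓ Vc y = Submodule.span ℝ (Set.range fun i => F.interForms i y) := by
  rw [F.zeroAdapted.span_hc y hy]
  refine le_antisymm (sup_le (sup_le ?_ ?_) ?_) (Submodule.span_le.2 ?_)
  · exact Submodule.span_mono (by rintro _ ⟨i, rfl⟩; exact ⟨Sum.inl i, rfl⟩)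
  · exact Submodule.span_mono (by rintro _ ⟨i, rfl⟩; exact ⟨Sum.inr (Sum.inl i), rfl⟩)
  · exact Submodule.span_mono (by rintro _ ⟨i, rfl⟩; exact ⟨Sum.inr (Sum.inr i), rfl⟩)
  · rintro _ ⟨i | i | i, rfl⟩
    · exact Submodule.mem_sup_left (Submodule.mem_sup_left (mem_sp _ _ i))
    · exact Submodule.mem_sup_left (Submodule.mem_sup_right (mem_sp _ _ i))
    · exact Submodule.mem_sup_right (mem_sp _ _ i)

theorem θX_mem {y : M} (hy : y ∈ F.O) (i : Fin F.r) : F.θX i y ∈ Vh y ⊓ Vc y := by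
  rw [F.span_interForms hy]
  exact Submodule.subset_span ⟨Sum.inl i, rfl⟩

variable {F}

theorem isVertical_X {y : M} (hy : y ∈ F.O) (j : Fin F.r) : IsVertical Vh Vc (F.X j y) := by
  have h := F.threeAdapted.dual_X
  constructor
  · rw [F.zeroAdapted.span_h y hy]
    exact sup_le (sp_le_covectorsVanishingAt fun a => h.pair_σh y hy a j)
      (sp_le_covectorsVanishingAt fun a => h.pair_ηh y hy a j)
  · rw [F.zeroAdapted.span_c y hy]
    exact sup_le (sp_le_covectorsVanishingAt fun a => h.pair_σc y hy a j)
      (sp_le_covectorsVanishingAt fun a => h.pair_ηc y hy a j)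

theorem interForms_inr_apply {y : M} (hy : y ∈ F.O) (i) {v : TangentSpace 𝓘(ℝ, E) y}
    (hv : IsVertical Vh Vc v) : F.interForms (Sum.inr i) y v = 0 := by
  rcases i with i | i
  · refine hv.hat ?_
    rw [F.zeroAdapted.span_h y hy]
    exact Submodule.mem_sup_right (mem_sp _ _ i)
  · refine hv.check ?_
    rw [F.zeroAdapted.span_c y hy]
    exact Submodule.mem_sup_right (mem_sp _ _ i)

/-- Each term of `dηh` or `dηc` has both factors in `πh` or both in `πc`, and these vanish on `v`;
one vertical argument is enough. -/
theorem extD_interForms_inr {y : M} (hy : y ∈ F.O) (i) (u : TangentSpace 𝓘(ℝ, E) y)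
    {v : TangentSpace 𝓘(ℝ, E) y} (hv : IsVertical Vh Vc v) :
    extD (F.interForms (Sum.inr i)) y u v = 0 := by
  have h := F.threeAdapted.twoAdapted_X
  have hh := hv.hat
  have hc := hv.check
  rw [F.zeroAdapted.span_h y hy, sup_le_iff] at hh
  rw [F.zeroAdapted.span_c y hy, sup_le_iff] at hc
  rcases i with i | i
  · exact sup_le (wedgeSpan_le_of_le (u := u) hh.2 hh.1) (wedgeSpan_le_of_le hh.1 hh.1)
      (h.d_ηh y hy i)
  · exact sup_le (wedgeSpan_le_of_le (u := u) hc.2 hc.1) (wedgeSpan_le_of_le hc.1 hc.1)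
      (h.d_ηc y hy i)

/-- Here the absence of `πc ∧ θX` in `dθX` is used: `u` need not be killed by `πc`. The terms `πh ∧
πh` and `πc ∧ πc` die on `v`, `θX ∧ θX` dies on `u`, and in `πh ∧ θX` the factor from `πh` dies on
both. -/
theorem extD_θX_of_annihilates {y : M} (hy : y ∈ F.O) (i : Fin F.r)
    {u v : TangentSpace 𝓘(ℝ, E) y} (hu : Vh y ≤ covectorsVanishingAt u)
    (hv : IsVertical Vh Vc v) : extD (F.θX i) y u v = 0 := by
  have hh := hv.hat
  have hc := hv.check
  have hu' := (derivedInf_le Vh y).trans hu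
  rw [F.zeroAdapted.span_h y hy] at hh hu'
  rw [F.zeroAdapted.span_c y hy] at hc
  have hθ : sp F.θX y ≤ covectorsVanishingAt u :=
    sp_le_covectorsVanishingAt fun j => hu (F.θX_mem hy j).1
  refine sup_le (sup_le (sup_le (wedgeSpan_le_of_le (u := u) hh hh) (wedgeSpan_le_of_le hc hc)) ?_)
    ?_ (F.threeAdapted.d_θX y hy i)
  · refine wedgeSpan_le_formsVanishingAt fun α hα β hβ => ?_
    rw [show α u = 0 from hθ hα, show β u = 0 from hθ hβ]; simp
  · refine wedgeSpan_le_formsVanishingAt fun α hα β hβ => ?_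
    rw [show α u = 0 from hu' hα, show α v = 0 from hh hα]; simp

theorem extD_θX_vertical {y : M} (hy : y ∈ F.O) (i : Fin F.r)
    {u v : TangentSpace 𝓘(ℝ, E) y} (hu : IsVertical Vh Vc u) (hv : IsVertical Vh Vc v) :
    extD (F.θX i) y u v = ∑ j, ∑ k, F.C i j k * F.θX j y u * F.θX k y v := by
  have hh := hv.hat
  have hc := hv.check
  have hh' := hu.hat
  rw [F.zeroAdapted.span_h y hy] at hh hh'
  rw [F.zeroAdapted.span_c y hy] at hc
  have key : _ ∈ formsVanishingAt u v := sup_le (sup_le (wedgeSpan_le_of_le (u := u) hh hh)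
    (wedgeSpan_le_of_le hc hc)) (wedgeSpan_le_formsVanishingAt fun α hα β hβ => by
      rw [show α u = 0 from hh' hα, show α v = 0 from hh hα]; simp) (F.structure_X y hy i)
  have key' : extD (F.θX i) y u v = (1 / 2 : ℝ) * ∑ j, ∑ k, F.C i j k *
      (F.θX j y u * F.θX k y v - F.θX j y v * F.θX k y u) := by
    have h : extD (F.θX i) y u v - ((1 / 2 : ℝ) • ∑ j, ∑ k, F.C i j k •
      wedge (F.θX j y) (F.θX k y)) u v = 0 := key
    rw [sub_eq_zero.1 h]
    simp [Finset.sum_apply, wedge]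
  -- Antisymmetry of `C` makes the two halves of the wedge contribute equally, absorbing the factor
  -- `1 / 2`.
  have hs : ∑ j, ∑ k, F.C i j k * (F.θX j y v * F.θX k y u) =
      -∑ j, ∑ k, F.C i j k * (F.θX j y u * F.θX k y v) := by
    rw [Finset.sum_comm, ← Finset.sum_neg_distrib]
    refine Finset.sum_congr rfl fun j _ => ?_
    rw [← Finset.sum_neg_distrib]
    refine Finset.sum_congr rfl fun k _ => ?_
    rw [F.antisymm i k j]
    ring
  simp only [key', mul_sub, Finset.sum_sub_distrib, hs, mul_assoc]
  ring

theorem θX_realize {y : M} (hy : y ∈ F.O) (v : F.Vess) (i : Fin F.r) :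
    F.θX i y (F.realize y v) = v i := by
  simp only [realize, map_sum, map_smul, F.threeAdapted.dual_X.pair_θ y hy, smul_eq_mul, mul_ite,
    mul_one, mul_zero]
  exact (Finset.sum_ite_eq Finset.univ i v).trans (if_pos (Finset.mem_univ i))

theorem isVertical_realize {y : M} (hy : y ∈ F.O) (v : F.Vess) :
    IsVertical Vh Vc (F.realize y v) := by
  constructor
  all_goals
    intro α hα
    change α (∑ i, v i • F.X i y) = 0
    rw [map_sum]
    refine Finset.sum_eq_zero fun i _ => ?_
    rw [map_smul]
  · rw [show α (F.X i y) = 0 from (isVertical_X hy i).hat hα, smul_zero]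
  · rw [show α (F.X i y) = 0 from (isVertical_X hy i).check hα, smul_zero]

/-- The `X i` span all vertical vectors. The difference of the two sides is killed by both maximal
integrable subsystems and by `Vh ∩ Vc`, and the sum conditions of a Darboux pair make these span the
cotangent space. -/
theorem realize_θX [FiniteDimensional ℝ E] (hV : IsDarbouxPair Vh Vc) {y : M} (hy : y ∈ F.O)
    {v : TangentSpace 𝓘(ℝ, E) y} (hv : IsVertical Vh Vc v) :
    F.realize y (fun i => F.θX i y v : Fin F.r → ℝ) = v := by
  let w : F.Vess := (fun i => F.θX i y v : Fin F.r → ℝ)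
  have hr := isVertical_realize hy w
  have h0 : ∀ α : TangentSpace 𝓘(ℝ, E) y →L[ℝ] ℝ, α (F.realize y w - v) = 0 := by
    have hz : ∀ {α}, α ∈ covectorsVanishingAt (F.realize y w) → α ∈ covectorsVanishingAt v →
        α ∈ covectorsVanishingAt (F.realize y w - v) := fun {α} h1 h2 => by
      change α _ = 0
      rw [map_sub, show α _ = 0 from h1, show α v = 0 from h2, sub_zero]
    have hVh : derivedInf Vh y ≤ covectorsVanishingAt (F.realize y w - v) :=
      fun α hα => hz (hr.hat hα) (hv.hat hα)
    have hVc : derivedInf Vc y ≤ covectorsVanishingAt (F.realize y w - v) :=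
      fun α hα => hz (hr.check hα) (hv.check hα)
    have hi : Vh y ⊓ Vc y ≤ covectorsVanishingAt (F.realize y w - v) := by
      rw [F.span_interForms hy]
      refine Submodule.span_le.2 ?_
      rintro _ ⟨i | i, rfl⟩
      · change F.θX i y _ = 0
        rw [map_sub, θX_realize hy]
        exact sub_self _
      · exact hz (interForms_inr_apply hy i hr) (interForms_inr_apply hy i hv)
    -- Modular law: `Vc + Vh^(∞) = T^*M` and `Vh^(∞) ≤ Vh` give `Vh = (Vh ∩ Vc) + Vh^(∞)`.
    have hVh' : Vh y ≤ covectorsVanishingAt (F.realize y w - v) := by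
      intro α hα
      have h : α ∈ Vc y ⊔ derivedInf Vh y := by rw [hV.sum_c y]; trivial
      obtain ⟨β, hβ, γ, hγ, rfl⟩ := Submodule.mem_sup.1 h
      refine Submodule.add_mem _ (hi ⟨?_, hβ⟩) (hVh hγ)
      simpa using Submodule.sub_mem _ hα (derivedInf_le Vh y hγ)
    intro α
    have h : α ∈ Vh y ⊔ derivedInf Vc y := by rw [hV.sum_h y]; trivial
    exact sup_le hVh' hVc h
  have h1 : ∀ a : E, (∀ α : E →L[ℝ] ℝ, α a = 0) → a = 0 := fun a ha => by
    by_contra hne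
    obtain ⟨f, hf⟩ := SeparatingDual.exists_ne_zero (R := ℝ) hne
    exact hf (ha f)
  exact sub_eq_zero.1 (h1 (F.realize y w - v) h0)

end FourAdaptedCoframe

end Coframes

/-! ### The pulled-back coframe restricted to vertical vectors. -/

section Morphism

variable {E : Type*} [NormedAddCommGroup E] [NormedSpace ℝ E] [FiniteDimensional ℝ E]
  {E' : Type*} [NormedAddCommGroup E'] [NormedSpace ℝ E']
  {M : Type*} [TopologicalSpace M] [ChartedSpace E M] [IsManifold 𝓘(ℝ, E) ∞ M]
  {N : Type*} [TopologicalSpace N] [ChartedSpace E' N] [IsManifold 𝓘(ℝ, E') ∞ N]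
  {Vh Vc : CoDistribution E M} {Wh Wc : CoDistribution E' N} {φ : M → N}

omit [FiniteDimensional ℝ E] in
theorem IsVertical.map (hV : IsDarbouxPair Vh Vc) (hW : IsDarbouxPair Wh Wc)
    (hφ : ContMDiff 𝓘(ℝ, E) 𝓘(ℝ, E') ∞ φ)
    (hh : ∀ x, ∀ τ ∈ Wh (φ x), τ.comp (mfderiv 𝓘(ℝ, E) 𝓘(ℝ, E') φ x) ∈ Vh x)
    (hc : ∀ x, ∀ τ ∈ Wc (φ x), τ.comp (mfderiv 𝓘(ℝ, E) 𝓘(ℝ, E') φ x) ∈ Vc x)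
    {y : M} {v : TangentSpace 𝓘(ℝ, E) y} (hv : IsVertical Vh Vc v) :
    IsVertical Wh Wc (mfderiv 𝓘(ℝ, E) 𝓘(ℝ, E') φ y v) :=
  ⟨fun _ hτ => hv.hat (pullback_mem_derivedInf hφ hV.integrable_h hW.integrable_h hh y hτ),
    fun _ hτ => hv.check (pullback_mem_derivedInf hφ hV.integrable_c hW.integrable_c hc y hτ)⟩

/-- On vertical vectors the coefficients of `φ^*θ'` behave as constants: their differentials lie in
`Vh`, hence in `Vh^(∞)`, and the Leibniz rule loses its derivative terms. -/
theorem exists_structure_pullback_θX (hV : IsDarbouxPair Vh Vc) (hW : IsDarbouxPair Wh Wc)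
    (hφ : ContMDiff 𝓘(ℝ, E) 𝓘(ℝ, E') ∞ φ)
    (hh : ∀ x, ∀ τ ∈ Wh (φ x), τ.comp (mfderiv 𝓘(ℝ, E) 𝓘(ℝ, E') φ x) ∈ Vh x)
    (hc : ∀ x, ∀ τ ∈ Wc (φ x), τ.comp (mfderiv 𝓘(ℝ, E) 𝓘(ℝ, E') φ x) ∈ Vc x)
    (F : FourAdaptedCoframe Vh Vc) (G : FourAdaptedCoframe Wh Wc)
    {x : M} (hx : x ∈ F.O) (hφx : φ x ∈ G.O) (s : Fin G.r) :
    ∃ R : Fin F.r → ℝ,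
      (∀ v : TangentSpace 𝓘(ℝ, E) x, IsVertical Vh Vc v →
        pullback φ (G.θX s) x v = ∑ i, R i * F.θX i x v) ∧
      ∀ u v : TangentSpace 𝓘(ℝ, E) x, IsVertical Vh Vc u → IsVertical Vh Vc v →
        extD (pullback φ (G.θX s)) x u v = ∑ i, R i * extD (F.θX i) x u v := by
  classical
  let U : Set M := F.O ∩ φ ⁻¹' G.O
  have hU : IsOpen U := F.zeroAdapted.isOpen.inter (G.zeroAdapted.isOpen.preimage hφ.continuous)
  have hGs : ∀ y ∈ U, SmoothFormAt (G.θX s) (φ y) := fun y hy =>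
    G.smoothFormAt_interForms hy.2 (Sum.inl s)
  obtain ⟨c, hcs, hce⟩ := exists_smooth_coefficients hU (α := pullback φ (G.θX s))
    (β := F.interForms) (fun y hy => smoothFormAt_pullback hφ (hGs y hy))
    (fun y hy => F.smoothFormAt_interForms hy.1) (fun y hy => F.linearIndependent_interForms hy.1)
    (fun y hy => by
      rw [← F.span_interForms hy.1]
      exact ⟨hh y _ (G.θX_mem hy.2 s).1, hc y _ (G.θX_mem hy.2 s).2⟩)
  have hd : ∀ y ∈ U, ∀ u v : TangentSpace 𝓘(ℝ, E) y, extD (pullback φ (G.θX s)) y u v =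
      ∑ i, (dForm (E := E) (c i) y u * F.interForms i y v -
        dForm (E := E) (c i) y v * F.interForms i y u + c i y * extD (F.interForms i) y u v) := by
    intro y hy u v
    rw [extD_congr (chartForm_eventuallyEq
      (τ' := fun y => ∑ i, c i y • F.interForms i y) (Filter.eventually_of_mem (hU.mem_nhds hy) hce)),
      extD_sum_smul (hcs y hy) (F.smoothFormAt_interForms hy.1)]
  have hcV : ∀ k : Fin F.r, ∀ y ∈ U, dForm (c (Sum.inl k)) y ∈ Vh y := by
    intro k y hy
    refine mem_of_vanishing (E := E) (Vh y) _ fun (u : TangentSpace 𝓘(ℝ, E) y) hu => ?_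
    have hu' : Vh y ≤ covectorsVanishingAt u := hu
    have hX := FourAdaptedCoframe.isVertical_X hy.1 k
    -- `φ_* u` is killed by `Wh` and `φ_* (X k)` is vertical, so the left side is zero by the
    -- structure equations on `N`; those on `M` remove everything on the right except `dc_k(u)`.
    have h1 := hd y hy u (F.X k y)
    rw [extD_pullback hφ (hGs y hy), FourAdaptedCoframe.extD_θX_of_annihilates hy.2 s
      (u := mfderiv 𝓘(ℝ, E) 𝓘(ℝ, E') φ y u) (fun τ hτ => hu' (hh y τ hτ)) (hX.map hV hW hφ hh hc), Fintype.sum_sum_type] at h1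
    have hu0 : ∀ i, F.interForms i y u = 0 := fun i => hu' (by
      have h : F.interForms i y ∈ Vh y ⊓ Vc y := by
        rw [F.span_interForms hy.1]; exact Submodule.subset_span ⟨i, rfl⟩
      exact h.1)
    have h2 : ∀ i, extD (F.interForms (Sum.inl i)) y u (F.X k y) = 0 := fun i =>
      FourAdaptedCoframe.extD_θX_of_annihilates hy.1 i hu' hX
    have h3 : ∀ i, F.interForms (Sum.inl i) y (F.X k y) = if i = k then 1 else 0 := fun i =>
      F.threeAdapted.dual_X.pair_θ y hy.1 i k
    simp only [hu0, h2, h3, FourAdaptedCoframe.interForms_inr_apply hy.1 _ hX,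
      FourAdaptedCoframe.extD_interForms_inr hy.1 _ _ hX] at h1
    simpa using! h1.symm
  have hx' : x ∈ U := ⟨hx, hφx⟩
  refine ⟨fun i => c (Sum.inl i) x, fun v hv => ?_, fun u v hu hv => ?_⟩
  · rw [hce x hx']
    refine Eq.trans (sum_apply (F := TangentSpace 𝓘(ℝ, E) x →L[ℝ] ℝ) Finset.univ _ v) ?_
    rw [Fintype.sum_sum_type]
    have h : ∀ i, (c (Sum.inr i) x • F.interForms (Sum.inr i) x) v = 0 := fun i => by
      rw [smul_apply, FourAdaptedCoframe.interForms_inr_apply hx i hv, smul_zero]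
    rw [Finset.sum_eq_zero (s := (Finset.univ : Finset (Fin F.qh ⊕ Fin F.qc))) fun i _ => h i,
      add_zero]
    rfl
  -- `ηh`, `ηc` and their differentials vanish here by verticality, so only the differentials of the
  -- `θX` coefficients need to be controlled.
  · have h0 : ∀ (i : Fin F.r) {w : TangentSpace 𝓘(ℝ, E) x}, IsVertical Vh Vc w →
        dForm (E := E) (c (Sum.inl i)) x w = 0 := fun i w hw =>
      hw.hat (dForm_mem_derivedInf hV.integrable_h hU (fun y hy => hcs y hy _) (hcV i) hx')
    rw [hd x hx' u v, Fintype.sum_sum_type]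
    simp only [h0 _ hu, h0 _ hv, FourAdaptedCoframe.interForms_inr_apply hx _ hu,
      FourAdaptedCoframe.interForms_inr_apply hx _ hv,
      FourAdaptedCoframe.extD_interForms_inr hx _ _ hv]
    simp [FourAdaptedCoframe.interForms]

end Morphism

end Vessiot

end

/-! ### The induced Lie algebra homomorphism. -/

theorem corollary4p7
    {E : Type*} [NormedAddCommGroup E] [NormedSpace ℝ E] [FiniteDimensional ℝ E]
    {E' : Type*} [NormedAddCommGroup E'] [NormedSpace ℝ E'] [FiniteDimensional ℝ E']
    {M : Type*} [TopologicalSpace M] [ChartedSpace E M] [IsManifold 𝓘(ℝ, E) ∞ M]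
    {N : Type*} [TopologicalSpace N] [ChartedSpace E' N] [IsManifold 𝓘(ℝ, E') ∞ N]
    (Vh Vc : Vessiot.CoDistribution E M) (Wh Wc : Vessiot.CoDistribution E' N)
    (hV : Vessiot.IsDarbouxPair Vh Vc) (hW : Vessiot.IsDarbouxPair Wh Wc)
    (φ : M → N) (hφ : ContMDiff 𝓘(ℝ, E) 𝓘(ℝ, E') ∞ φ)
    (hh : ∀ x, ∀ τ ∈ Wh (φ x), τ.comp (mfderiv 𝓘(ℝ, E) 𝓘(ℝ, E') φ x) ∈ Vh x)
    (hc : ∀ x, ∀ τ ∈ Wc (φ x), τ.comp (mfderiv 𝓘(ℝ, E) 𝓘(ℝ, E') φ x) ∈ Vc x)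
    (F : Vessiot.FourAdaptedCoframe Vh Vc) (G : Vessiot.FourAdaptedCoframe Wh Wc)
    (x : M) (hx : x ∈ F.O) (hφx : φ x ∈ G.O) :
    ∃! Φ : F.Vess →ₗ⁅ℝ⁆ G.Vess, ∀ v : F.Vess,
      mfderiv 𝓘(ℝ, E) 𝓘(ℝ, E') φ x (F.realize x v) = G.realize (φ x) (Φ v) := by
  have hRex := fun s => Vessiot.exists_structure_pullback_θX hV hW hφ hh hc F G hx hφx s
  choose R hR hdR using hRex
  have hver : ∀ v : F.Vess, Vessiot.IsVertical Vh Vc (F.realize x v) := fun v =>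
    Vessiot.FourAdaptedCoframe.isVertical_realize hx v
  have hR' : ∀ s (v : F.Vess), G.θX s (φ x) (mfderiv 𝓘(ℝ, E) 𝓘(ℝ, E') φ x (F.realize x v)) =
      ∑ i, R s i * v i := fun s v => by
    refine (hR s _ (hver v)).trans (Finset.sum_congr rfl fun i _ => ?_)
    rw [Vessiot.FourAdaptedCoframe.θX_realize hx]
  let L : F.Vess →ₗ[ℝ] G.Vess :=
    { toFun := fun v => (fun s => ∑ i, R s i * v i : Fin G.r → ℝ)
      map_add' := fun u v => by
        funext s
        change ∑ i, R s i * (u i + v i) = ∑ i, R s i * u i + ∑ i, R s i * v i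
        simp only [mul_add, Finset.sum_add_distrib]
      map_smul' := fun a v => by
        funext s
        change ∑ i, R s i * (a * v i) = a * ∑ i, R s i * v i
        rw [Finset.mul_sum]
        exact Finset.sum_congr rfl fun i _ => by ring }
  have hL : ∀ (v : F.Vess) s, L v s = ∑ i, R s i * v i := fun _ _ => rfl
  have hlie : ∀ u v : F.Vess, L ⁅u, v⁆ = ⁅L u, L v⁆ := fun u v => by
    funext s
    have hs : Vessiot.SmoothFormAt (G.θX s) (φ x) :=
      G.smoothFormAt_interForms hφx (Sum.inl s)
    -- Expanding both sides by the structure equations turns this into `∑ C' (Lu)(Lv) = ∑ R C u v`,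
    -- the bracket relation.
    have h := hdR s _ _ (hver u) (hver v)
    rw [Vessiot.extD_pullback hφ hs, Vessiot.FourAdaptedCoframe.extD_θX_vertical hφx s
      ((hver u).map hV hW hφ hh hc) ((hver v).map hV hW hφ hh hc)] at h
    rw [Vessiot.FourAdaptedCoframe.lie_apply, hL]
    simp only [hR'] at h
    simp only [hL]
    rw [h]
    refine Finset.sum_congr rfl fun i _ => ?_
    rw [Vessiot.FourAdaptedCoframe.extD_θX_vertical hx i (hver u) (hver v),
      Vessiot.FourAdaptedCoframe.lie_apply]
    simp only [Vessiot.FourAdaptedCoframe.θX_realize hx]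
  refine ⟨{ L with map_lie' := fun {u v} => hlie u v }, fun v => ?_, fun Φ hΦ => ?_⟩
  -- The image under `φ_*` is vertical, so its `θX` components, which are the entries of `L v`,
  -- determine it.
  · rw [← Vessiot.FourAdaptedCoframe.realize_θX hW hφx ((hver v).map hV hW hφ hh hc)]
    congr 1
    funext s
    exact hR' s v
  -- Uniqueness: pairing with `θX` recovers `Φ v` from its realization.
  · refine LieHom.ext fun v => ?_
    funext s
    have h := hR' s v
    rw [hΦ v, Vessiot.FourAdaptedCoframe.θX_realize hφx] at h
    exact h
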